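/- **Setting.** Fix one of the two instances of the VIR semantics, with unbounded-integer addresses ($X=\mathrm{inf}$) or 64-bit addresses ($X=\mathrm{fin}$); fix a meaning of the intrinsics (each intrinsic call is assigned an interaction tree over the remaining events), and fix an initial global environment $g$, local environment $l$ and memory $m$ (a memory configuration together with the next store identifier). Let $\mathcal V$ be the dynamic values, and let $E_0,\dots,E_5$ be the event signatures where $E_5$ consists of external calls, debug messages, $\mathrm{UB}$, $\mathrm{OOM}$ and failure, and $E_4,E_3,E_2,E_1,E_0$ add successively the nondeterminism (pick) events, the memory events, the local-environment events, the global-environment events and the intrinsic calls. There are eight levels of interpretation. A *behaviour* at level $\ell$ is an interaction tree in $\mathrm{itree}\,E_0\,\mathcal V$ ($\ell=0$), $\mathrm{itree}\,E_1\,\mathcal V$ ($\ell=1$), $\mathrm{itree}\,E_2\,(Env_G\times\mathcal V)$ ($\ell=2$), $\mathrm{itree}\,E_3\,(Env_L\times(Env_G\times\mathcal V))$ ($\ell=3$), or a set of interaction trees in $\mathrm{itree}\,E_4\,(Mem\times(Env_L\times(Env_G\times\mathcal V)))$ ($\ell=4$) or in $\mathrm{itree}\,E_5\,(Mem\times(Env_L\times(Env_G\times\mathcal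 V)))$ ($\ell=5,6,7$). Interpretation steps lead from each level to the next: the intrinsics, the global environment (from $g$) and the local environment (from $l$) are interpreted by their handlers ($0\to1\to2\to3$); the memory events are interpreted, from $m$, by the nondeterministic specification of the memory model, giving the set of all resulting trees ($3\to4$); the pick events are interpreted by choosing concretizations of under-defined values, in each tree of the set ($4\to5$); $\mathrm{UB}$ is modelled by adding every tree if some tree of the set may reach a $\mathrm{UB}$ event ($5\to6$); $\mathrm{OOM}$ is modelled by adding every tree $u$ with $\mathrm{eutt\_oom}_{=}(t,u)$ for some tree $t$ of the set ($6\to7$). Level $7$ is the top level, $\mathrm{VIR}$. For $\ell\le\ell'$ write $[\![P]\!]_{\ell\to\ell'}$ for the interpretation of a level-$\ell$ behaviour $P$ down to level $\ell'$. Let $\mathrm{eutt}_R$ be equivalence up to finitely many silent steps with relation $R$ on results, let $\mathrm{eutt\_oom}_R$ be the same weak simulation in which moreover an $\mathrm{OOM}$ event on the right is related to every tree on the left, let $\mathrm{hasUB}(t)$ say that $t$ may reach a $\mathrm{UB}$ event, and let $\approx$ relate two results when their values in $\mathcal V$ are equal, ignoring environments and memories. *Refinement* $P\sqsupseteq_\ell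 Q$ ($Q$ refines $P$) is defined by - $\mathrm{eutt}_\approx(P,Q)$ for $\ell\le 3$; - $\forall t'\in Q,\ \exists t\in P,\ \mathrm{eutt}_\approx(t,t')$ for $\ell=4,5$; - $\forall t'\in Q,\ \exists t\in P,\ \mathrm{hasUB}(t)\lor\mathrm{eutt}_\approx(t,t')$ for $\ell=6$; - $\forall t'\in Q,\ \exists t\in P,\ \mathrm{hasUB}(t)\lor\mathrm{eutt\_oom}_\approx(t,t')$ for $\ell=7$, also written $P\sqsupseteq_{\mathrm{VIR}}Q$. **Theorem (Level refinement).** 1. For all levels $\ell\le\ell'$ and all behaviours $P,Q$ at level $\ell$: if $P\sqsupseteq_\ell Q$, then $[\![P]\!]_{\ell\to\ell'}\sqsupseteq_{\ell'}[\![Q]\!]_{\ell\to\ell'}$. 2. In particular, for every level $\ell$ and all behaviours $P,Q$ at level $\ell$: if $P\sqsupseteq_\ell Q$, then $[\![P]\!]_{\ell\to 7}\sqsupseteq_{\mathrm{VIR}}[\![Q]\!]_{\ell\to 7}$. 3. Since levels $5,6,7$ have the same behaviours, the refinements there can also be compared without reinterpretation: for all sets $P,Q$ of trees in $\mathrm{itree}\,E_5\,(Mem\times(Env_L\times(Env_G\times\mathcal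 V)))$, $P\sqsupseteq_5Q$ implies $P\sqsupseteq_6Q$, and $P\sqsupseteq_6Q$ implies $P\sqsupseteq_{\mathrm{VIR}}Q$. -/

import Mathlib

namespace VIR

/-! ## Interaction trees

An event signature is a type of events together with the type of answers of each event.
The tree type `ITree E R` is the final coalgebra of `R + X + Σ e, (E.Ans e → X)`. -/

structure Sig where
  Op : Type
  Ans : Op → Type

/-- Disjoint union of two event signatures. -/
def Sig.sum (E F : Sig) : Sig where
  Op := E.Op ⊕ F.Op
  Ans := fun e => match e with
    | .inl e => E.Ans e
    | .inr f => F.Ans f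

/-- One layer of an interaction tree. -/
inductive Step (E : Sig) (R S : Type) : Type
  | ret (r : R)
  | tau (s : S)
  | vis (e : E.Op) (k : E.Ans e → S)

inductive Shape (E : Sig) (R : Type) : Type
  | ret (r : R)
  | tau
  | vis (e : E.Op)

def Shape.Arity {E : Sig} {R : Type} : Shape E R → Type
  | .ret _ => Empty
  | .tau => Unit
  | .vis e => E.Ans e

/-- Interaction trees over the events `E` with results in `R`. -/
def ITree (E : Sig) (R : Type) : Type := PFunctor.M ⟨Shape E R, Shape.Arity⟩

def Step.toObj {E : Sig} {R S : Type} :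
    Step E R S → PFunctor.Obj ⟨Shape E R, Shape.Arity⟩ S
  | .ret r => ⟨.ret r, fun x => Empty.elim x⟩
  | .tau s => ⟨.tau, fun _ => s⟩
  | .vis e k => ⟨.vis e, k⟩

def Step.ofObj {E : Sig} {R S : Type} :
    PFunctor.Obj ⟨Shape E R, Shape.Arity⟩ S → Step E R S
  | ⟨.ret r, _⟩ => .ret r
  | ⟨.tau, k⟩ => .tau (k ())
  | ⟨.vis e, k⟩ => .vis e k

namespace ITree

variable {E F H : Sig} {R R' S : Type}

/-- The topmost layer of a tree. -/
def observe (t : ITree E R) : Step E R (ITree E R) := Step.ofObj (PFunctor.M.dest t)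

/-- The tree with a given topmost layer. -/
def fold (s : Step E R (ITree E R)) : ITree E R := PFunctor.M.mk s.toObj

def ret (r : R) : ITree E R := fold (.ret r)
def tau (t : ITree E R) : ITree E R := fold (.tau t)
def vis (e : E.Op) (k : E.Ans e → ITree E R) : ITree E R := fold (.vis e k)

/-- Corecursion. -/
def unfold (f : S → Step E R S) (s : S) : ITree E R :=
  PFunctor.M.corec (fun s => (f s).toObj) s

theorem observe_fold (s : Step E R (ITree E R)) : observe (fold s) = s := by
  cases s <;> rfl

theorem observe_unfold (f : S → Step E R S) (s : S) :
    observe (unfold f s) = match f s with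
      | .ret r => .ret r
      | .tau s' => .tau (unfold f s')
      | .vis e k => .vis e (fun a => unfold f (k a)) := by
  have h : observe (unfold f s) = Step.ofObj
      (PFunctor.map ⟨Shape E R, Shape.Arity⟩ (unfold f) (f s).toObj) :=
    congrArg Step.ofObj (PFunctor.M.dest_corec (fun s => (f s).toObj) s)
  rw [h]
  cases f s <;> rfl

/-- Apply a function to the results of a tree. -/
def map (g : R → R') (t : ITree E R) : ITree E R' :=
  unfold (fun t : ITree E R => match observe t with
    | .ret r => .ret (g r)
    | .tau t' => .tau t'
    | .vis e k => .vis e k) t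

/-- Stateful interpretation of the events `H`, by a handler `h` that turns an event and a state
into a tree over the remaining events `F`, returning a new state and an answer. The state of the
corecursion is the part of the current handler computation that is still to be run, which returns
the next state and the rest of the interpreted tree. -/
def interpState (h : (e : H.Op) → S → ITree F (S × H.Ans e)) (t : ITree (H.sum F) R) (s : S) :
    ITree F (S × R) :=
  unfold (fun u : ITree F (S × ITree (H.sum F) R) => match observe u with
    | .tau u' => .tau u'
    | .vis f k => .vis f k
    | .ret (s, t) => match observe t with
      | .ret r => .ret (s, r)
      | .tau t' => .tau (ret (s, t'))
      | .vis (.inl e) k => .tau (map (fun p : S × H.Ans e => (p.1, k p.2)) (h e s))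
      | .vis (.inr f) k => .vis f (fun a => ret (s, k a)))
    (ret (s, t))

/-- Stateless interpretation of the events `H`. -/
def interp (h : (e : H.Op) → ITree F (H.Ans e)) (t : ITree (H.sum F) R) : ITree F R :=
  map Prod.snd (interpState (fun e (s : Unit) => map (fun a => (s, a)) (h e)) t ())

/-- One step of the weak simulation `WeakSim`; `tau` steps may be skipped finitely often on either
side. -/
inductive WeakSimF (RR : R → R' → Prop) (cut : ITree E R' → Prop)
    (sim : ITree E R → ITree E R' → Prop) : ITree E R → ITree E R' → Prop
  | ret {t : ITree E R} {u : ITree E R'} (a : R) (b : R') (ht : observe t = .ret a)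
      (hu : observe u = .ret b) (hab : RR a b) : WeakSimF RR cut sim t u
  | tau {t : ITree E R} {u : ITree E R'} (t' : ITree E R) (u' : ITree E R')
      (ht : observe t = .tau t') (hu : observe u = .tau u') (h : sim t' u') :
      WeakSimF RR cut sim t u
  | vis {t : ITree E R} {u : ITree E R'} (e : E.Op) (k : E.Ans e → ITree E R)
      (k' : E.Ans e → ITree E R') (ht : observe t = .vis e k) (hu : observe u = .vis e k')
      (h : ∀ a, sim (k a) (k' a)) : WeakSimF RR cut sim t u
  | tauL {t : ITree E R} {u : ITree E R'} (t' : ITree E R) (ht : observe t = .tau t')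
      (h : WeakSimF RR cut sim t' u) : WeakSimF RR cut sim t u
  | tauR {t : ITree E R} {u : ITree E R'} (u' : ITree E R') (hu : observe u = .tau u')
      (h : WeakSimF RR cut sim t u') : WeakSimF RR cut sim t u
  | cut {t : ITree E R} {u : ITree E R'} (hu : cut u) : WeakSimF RR cut sim t u

/-- The greatest fixed point of `WeakSimF`. -/
def WeakSim (RR : R → R' → Prop) (cut : ITree E R' → Prop) (t : ITree E R) (u : ITree E R') :
    Prop :=
  ∃ sim : ITree E R → ITree E R' → Prop,
    (∀ t u, sim t u → WeakSimF RR cut sim t u) ∧ sim t u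

/-- Equivalence up to taus, with the relation `RR` on results. -/
def Eutt (RR : R → R' → Prop) (t : ITree E R) (u : ITree E R') : Prop :=
  WeakSim RR (fun _ => False) t u

end ITree

/-- The three exceptional outcomes. -/
inductive Err
  | ub
  | oom
  | fail

/-- `UB + OOM + FAIL + ok A`. -/
inductive Outcome (A : Type) : Type
  | ok (a : A)
  | err (e : Err)

namespace ITree

variable {F H : Sig} {R R' S : Type}

/-- One step of `Runs`: the events `H` are resolved by the specification `h`, each occurrence
independently of the others, and the events `F` are kept. An error of the specification becomes
the corresponding event of `F`. -/
inductive RunsF (raise : Err → F.Op) (h : (e : H.Op) → S → Set (Outcome (S × H.Ans e)))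
    (out : S → R → R') (sim : ITree (H.sum F) R → S → ITree F R' → Prop) :
    ITree (H.sum F) R → S → ITree F R' → Prop
  | ret {t : ITree (H.sum F) R} {s : S} {u : ITree F R'} (r : R) (ht : observe t = .ret r)
      (hu : observe u = .ret (out s r)) : RunsF raise h out sim t s u
  | tau {t : ITree (H.sum F) R} {s : S} {u : ITree F R'} (t' : ITree (H.sum F) R)
      (u' : ITree F R') (ht : observe t = .tau t') (hu : observe u = .tau u')
      (hs : sim t' s u') : RunsF raise h out sim t s u
  | keep {t : ITree (H.sum F) R} {s : S} {u : ITree F R'} (f : F.Op)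
      (k : F.Ans f → ITree (H.sum F) R) (k' : F.Ans f → ITree F R')
      (ht : observe t = .vis (.inr f) k) (hu : observe u = .vis f k')
      (hs : ∀ a, sim (k a) s (k' a)) : RunsF raise h out sim t s u
  | ok {t : ITree (H.sum F) R} {s : S} {u : ITree F R'} (e : H.Op)
      (k : H.Ans e → ITree (H.sum F) R) (s' : S) (a : H.Ans e) (u' : ITree F R')
      (ht : observe t = .vis (.inl e) k) (he : Outcome.ok (s', a) ∈ h e s)
      (hu : observe u = .tau u') (hs : sim (k a) s' u') : RunsF raise h out sim t s u
  | err {t : ITree (H.sum F) R} {s : S} {u : ITree F R'} (e : H.Op)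
      (k : H.Ans e → ITree (H.sum F) R) (x : Err) (k' : F.Ans (raise x) → ITree F R')
      (ht : observe t = .vis (.inl e) k) (he : Outcome.err x ∈ h e s)
      (hu : observe u = .vis (raise x) k') : RunsF raise h out sim t s u

/-- `u` is one of the behaviours of `t`, started in state `s`, under the nondeterministic
specification `h` of the events `H`: the greatest fixed point of `RunsF`. -/
def Runs (raise : Err → F.Op) (h : (e : H.Op) → S → Set (Outcome (S × H.Ans e)))
    (out : S → R → R') (t : ITree (H.sum F) R) (s : S) (u : ITree F R') : Prop :=
  ∃ sim : ITree (H.sum F) R → S → ITree F R' → Prop,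
    (∀ t s u, sim t s u → RunsF raise h out sim t s u) ∧ sim t s u

end ITree

/-! ## Types and values -/

/-- The two instances of the memory model. -/
inductive Phase
  | inf
  | fin

/-- Physical addresses, which are also the values of type `iptr`. -/
def Phase.Addr : Phase → Type
  | .inf => ℤ
  | .fin => BitVec 64

def Addr.toInt : {X : Phase} → X.Addr → ℤ
  | .inf, z => z
  | .fin, v => (BitVec.toNat (w := 64) v : ℤ)

/-- The address with a given integer value; `none` if it is out of bounds. -/
def Addr.ofInt : (X : Phase) → ℤ → Option X.Addr
  | .inf, z => some z
  | .fin, z => if 0 ≤ z ∧ z < 2 ^ 64 then some (BitVec.ofInt 64 z) else none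

def Addr.ofBits : (X : Phase) → BitVec 64 → X.Addr
  | .inf, v => (v.toNat : ℤ)
  | .fin, v => v

/-- Address arithmetic; `none` signals an overflow (out of memory). -/
def Addr.plus {X : Phase} (a : X.Addr) (n : ℕ) : Option X.Addr := Addr.ofInt X (Addr.toInt a + n)

/-- Provenances; `none` is the wildcard that results from integer-to-pointer casts. -/
abbrev Prov : Type := Option ℕ

structure Ptr (X : Phase) where
  a : X.Addr
  pr : Prov

/-- The fixed-size integer types. -/
inductive IntW
  | i1 | i8 | i16 | i32 | i64

def IntW.bits : IntW → ℕ
  | .i1 => 1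
  | .i8 => 8
  | .i16 => 16
  | .i32 => 32
  | .i64 => 64

def IntW.bytes : IntW → ℕ
  | .i1 => 1
  | .i8 => 1
  | .i16 => 2
  | .i32 => 4
  | .i64 => 8

inductive DTyp
  | void
  | int (w : IntW)
  | iptr
  | ptr
  | array (n : ℕ) (τ : DTyp)

/-- Size in bytes of the values of a type. -/
def DTyp.size : DTyp → ℕ
  | .void => 0
  | .int w => w.bytes
  | .iptr => 8
  | .ptr => 8
  | .array n τ => n * τ.size

/-- Dynamic values; `unit` is the void value. -/
inductive DVal (X : Phase) : Type
  | unit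
  | addr (p : Ptr X)
  | array (vs : List (DVal X))
  | int (w : IntW) (v : BitVec w.bits)
  | iptr (i : X.Addr)
  | poison (τ : DTyp)

inductive DVal.HasTyp {X : Phase} : DVal X → DTyp → Prop
  | unit : HasTyp .unit .void
  | addr (p : Ptr X) : HasTyp (.addr p) .ptr
  | array (vs : List (DVal X)) (τ : DTyp) (h : ∀ v ∈ vs, HasTyp v τ) :
      HasTyp (.array vs) (.array vs.length τ)
  | int (w : IntW) (v : BitVec w.bits) : HasTyp (.int w v) (.int w)
  | iptr (i : X.Addr) : HasTyp (.iptr i) .iptr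
  | poison (τ : DTyp) : HasTyp (.poison τ) τ

/-- Comparison predicates. -/
inductive Cmp
  | eq | ne | ugt | uge | ult | ule | sgt | sge | slt | sle

/-- Binary operations, with their `nuw`, `nsw` and `exact` flags. The operation `gep τ` offsets a
pointer by a number of elements of type `τ`. -/
inductive BinOp
  | add (nuw nsw : Bool)
  | sub (nuw nsw : Bool)
  | mul (nuw nsw : Bool)
  | shl (nuw nsw : Bool)
  | udiv (exact : Bool)
  | sdiv (exact : Bool)
  | lshr (exact : Bool)
  | ashr (exact : Bool)
  | urem
  | srem
  | and
  | or
  | xor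
  | icmp (c : Cmp)
  | gep (τ : DTyp)

/-- Conversions. -/
inductive Conv
  | trunc | zext | sext | ptrtoint | inttoptr | bitcast

mutual

/-- Under-defined values. -/
inductive UVal (X : Phase) : Type
  | ofD (dv : DVal X)
  | array (us : List (UVal X))
  | undef (τ : DTyp)
  | op (o : BinOp) (x y : UVal X)
  | conv (c : Conv) (x : UVal X) (τ : DTyp)
  | select (τ : DTyp) (c x y : UVal X)
  | concat (bs : List (SByte X)) (τ : DTyp)

/-- Symbolic bytes: byte number `i` of the value `uv`, stored at type `τ` by the store `sid`. -/
inductive SByte (X : Phase) : Type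
  | mk (τ : DTyp) (uv : UVal X) (i : ℕ) (sid : ℕ)

end

def SByte.uv {X : Phase} : SByte X → UVal X
  | .mk _ u _ _ => u

def SByte.idx {X : Phase} : SByte X → ℕ
  | .mk _ _ i _ => i

def SByte.sid {X : Phase} : SByte X → ℕ
  | .mk _ _ _ s => s

/-! ## Concrete bytes and evaluation of operations -/

/-- A concrete byte; `none` is a byte of a poison value. -/
abbrev CByte : Type := Option (BitVec 8)

/-- The `n` low-order bytes of an integer, least significant first. -/
def leBytes (n : ℕ) (z : ℤ) : List CByte :=
  (List.range n).map fun i => some (BitVec.ofInt 8 (z / 2 ^ (8 * i)))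

/-- The natural number with the given bytes, least significant first; `none` if one is poison. -/
def leNat : List CByte → Option ℕ
  | [] => some 0
  | none :: _ => none
  | some b :: bs => (leNat bs).map fun n => b.toNat + 256 * n

mutual

/-- The bytes of a dynamic value. Addresses and values of type `iptr` occupy eight bytes, so the
unbounded ones are truncated when they are accessed bytewise. -/
def DVal.toBytes {X : Phase} : DVal X → List CByte
  | .unit => []
  | .addr p => leBytes 8 (Addr.toInt p.a)
  | .array vs => DVal.listToBytes vs
  | .int w v => leBytes w.bytes v.toNat
  | .iptr i => leBytes 8 (Addr.toInt i)
  | .poison τ => List.replicate τ.size none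

def DVal.listToBytes {X : Phase} : List (DVal X) → List CByte
  | [] => []
  | v :: vs => DVal.toBytes v ++ DVal.listToBytes vs

end

/-- The first `n` bytes of a list, padded with zeros. -/
def fit (n : ℕ) (bs : List CByte) : List CByte :=
  (List.range n).map fun i => bs.getD i (some 0)

/-- The value of type `τ` with the given bytes (truncated or padded with zeros). Pointers
obtained in this way have the wildcard provenance. -/
def DVal.ofBytes (X : Phase) : DTyp → List CByte → DVal X
  | .void, _ => .unit
  | .int w, bs => match leNat (fit w.bytes bs) with
    | some n => .int w (BitVec.ofNat _ n)
    | none => .poison (.int w)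
  | .iptr, bs => match leNat (fit 8 bs) with
    | some n => .iptr (Addr.ofBits X (BitVec.ofNat _ n))
    | none => .poison .iptr
  | .ptr, bs => match leNat (fit 8 bs) with
    | some n => .addr ⟨Addr.ofBits X (BitVec.ofNat _ n), none⟩
    | none => .poison .ptr
  | .array n τ, bs =>
    .array ((List.range n).map fun i => DVal.ofBytes X τ (bs.drop (i * τ.size)))

def DVal.ofBool {X : Phase} (b : Bool) : DVal X := .int .i1 (BitVec.ofBool b)

def Cmp.evalBits {n : ℕ} (c : Cmp) (x y : BitVec n) : Bool :=
  match c with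
  | .eq => x == y
  | .ne => x != y
  | .ugt => y.ult x
  | .uge => y.ule x
  | .ult => x.ult y
  | .ule => x.ule y
  | .sgt => y.slt x
  | .sge => y.sle x
  | .slt => x.slt y
  | .sle => x.sle y

def Cmp.evalInt (c : Cmp) (x y : ℤ) : Bool :=
  match c with
  | .eq => decide (x = y)
  | .ne => decide (x ≠ y)
  | .ugt => decide (x > y)
  | .uge => decide (x ≥ y)
  | .ult => decide (x < y)
  | .ule => decide (x ≤ y)
  | .sgt => decide (x > y)
  | .sge => decide (x ≥ y)
  | .slt => decide (x < y)
  | .sle => decide (x ≤ y)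

/-- Operations on integers of a fixed size; a violated flag yields poison. -/
def BinOp.evalBits {X : Phase} (o : BinOp) (w : IntW) (x y : BitVec w.bits) : Outcome (DVal X) :=
  let val (poison : Bool) (r : BitVec w.bits) : Outcome (DVal X) :=
    .ok (if poison then .poison (.int w) else .int w r)
  match o with
  | .add nuw nsw => val (nuw && x.uaddOverflow y || nsw && x.saddOverflow y) (x + y)
  | .sub nuw nsw => val (nuw && x.usubOverflow y || nsw && x.ssubOverflow y) (x - y)
  | .mul nuw nsw => val (nuw && x.umulOverflow y || nsw && x.smulOverflow y) (x * y)
  | .shl nuw nsw =>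
    let r := x <<< y.toNat
    val (decide (w.bits ≤ y.toNat) || nuw && (r >>> y.toNat) != x ||
      nsw && (r.sshiftRight y.toNat) != x) r
  | .udiv exact => if y = 0 then .err .ub else val (exact && x.umod y != 0) (x.udiv y)
  | .sdiv exact =>
    if y = 0 ∨ x.sdivOverflow y then .err .ub else val (exact && x.srem y != 0) (x.sdiv y)
  | .lshr exact =>
    let r := x >>> y.toNat
    val (decide (w.bits ≤ y.toNat) || exact && (r <<< y.toNat) != x) r
  | .ashr exact =>
    let r := x.sshiftRight y.toNat
    val (decide (w.bits ≤ y.toNat) || exact && (r <<< y.toNat) != x) r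
  | .urem => if y = 0 then .err .ub else val false (x.umod y)
  | .srem => if y = 0 ∨ x.sdivOverflow y then .err .ub else val false (x.srem y)
  | .and => val false (x &&& y)
  | .or => val false (x ||| y)
  | .xor => val false (x ^^^ y)
  | .icmp c => .ok (.ofBool (c.evalBits x y))
  | .gep _ => .err .fail

/-- Operations on `iptr`, carried out in `ℤ`: a result that does not fit in the address type is
out of memory. -/
def BinOp.evalIptr (X : Phase) (o : BinOp) (x y : ℤ) : Outcome (DVal X) :=
  let val (z : ℤ) : Outcome (DVal X) := match Addr.ofInt X z with
    | some i => .ok (.iptr i)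
    | none => .err .oom
  match o with
  | .add _ _ => val (x + y)
  | .sub _ _ => val (x - y)
  | .mul _ _ => val (x * y)
  | .shl _ _ => if y < 0 then .err .fail else val (x * 2 ^ y.toNat)
  | .udiv exact | .sdiv exact =>
    if y = 0 then .err .ub
    else if exact && x.tmod y != 0 then .ok (.poison .iptr) else val (x.tdiv y)
  | .lshr exact | .ashr exact =>
    if y < 0 then .err .fail
    else if exact && x % 2 ^ y.toNat != 0 then .ok (.poison .iptr) else val (x / 2 ^ y.toNat)
  | .urem | .srem => if y = 0 then .err .ub else val (x.tmod y)
  | .and => val (Int.land x y)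
  | .or => val (Int.lor x y)
  | .xor => val (Int.xor x y)
  | .icmp c => .ok (.ofBool (c.evalInt x y))
  | .gep _ => .err .fail

def evalGep {X : Phase} (τ : DTyp) (p : Ptr X) (i : ℤ) : Outcome (DVal X) :=
  match Addr.ofInt X (Addr.toInt p.a + τ.size * i) with
  | some a => .ok (.addr ⟨a, p.pr⟩)
  | none => .err .oom

def BinOp.isDivision : BinOp → Bool
  | .udiv _ | .sdiv _ | .urem | .srem => true
  | _ => false

/-- The type of the result of an operation on operands of type `τ`. -/
def BinOp.resultTyp (o : BinOp) (τ : DTyp) : DTyp :=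
  match o with
  | .icmp _ => .int .i1
  | .gep _ => .ptr
  | _ => τ

def DVal.isZero {X : Phase} : DVal X → Bool
  | .int _ v => v == 0
  | .iptr i => Addr.toInt i == 0
  | _ => false

/-- Evaluation of binary operations. Poison propagates, except that a division by poison or by
zero is undefined behaviour; ill-typed operands are a failure. -/
def BinOp.eval {X : Phase} (o : BinOp) (x y : DVal X) : Outcome (DVal X) :=
  match x, y with
  | .poison τ, y => match y with
    | .poison _ => if o.isDivision then .err .ub else .ok (.poison (o.resultTyp τ))
    | y => if o.isDivision && y.isZero then .err .ub else .ok (.poison (o.resultTyp τ))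
  | _, .poison τ => if o.isDivision then .err .ub else .ok (.poison (o.resultTyp τ))
  | .int w v, .int w' v' =>
    if w.bits = w'.bits then o.evalBits w v (v'.setWidth w.bits) else .err .fail
  | .iptr i, .iptr j => o.evalIptr X (Addr.toInt i) (Addr.toInt j)
  | .addr p, .int _ v => match o with
    | .gep τ => evalGep τ p v.toInt
    | _ => .err .fail
  | .addr p, .iptr i => match o with
    | .gep τ => evalGep τ p (Addr.toInt i)
    | _ => .err .fail
  | .addr p, .addr q => match o with
    | .icmp c => .ok (.ofBool (c.evalInt (Addr.toInt p.a) (Addr.toInt q.a)))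
    | _ => .err .fail
  | _, _ => .err .fail

def iptrOfInt (X : Phase) (z : ℤ) : Outcome (DVal X) :=
  match Addr.ofInt X z with
  | some i => .ok (.iptr i)
  | none => .err .oom

def ptrOfInt (X : Phase) (z : ℤ) : Outcome (DVal X) :=
  match Addr.ofInt X z with
  | some a => .ok (.addr ⟨a, none⟩)
  | none => .err .oom

/-- Evaluation of conversions to the type `τ`. Casts between pointers and `iptr` are no-ops on the
address; integers do not carry provenance. -/
def Conv.eval {X : Phase} (c : Conv) (x : DVal X) (τ : DTyp) : Outcome (DVal X) :=
  match c, x, τ with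
  | _, .poison _, τ => .ok (.poison τ)
  | .trunc, .int w v, .int w' =>
    if w'.bits < w.bits then .ok (.int w' (v.setWidth _)) else .err .fail
  | .trunc, .iptr i, .int w => .ok (.int w (BitVec.ofInt _ (Addr.toInt i)))
  | .zext, .int w v, .int w' =>
    if w.bits < w'.bits then .ok (.int w' (v.setWidth _)) else .err .fail
  | .zext, .int _ v, .iptr => iptrOfInt X v.toNat
  | .sext, .int w v, .int w' =>
    if w.bits < w'.bits then .ok (.int w' (v.signExtend _)) else .err .fail
  | .sext, .int _ v, .iptr => iptrOfInt X v.toInt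
  | .ptrtoint, .addr p, .iptr => .ok (.iptr p.a)
  | .ptrtoint, .addr p, .int w => .ok (.int w (BitVec.ofInt _ (Addr.toInt p.a)))
  | .inttoptr, .iptr i, .ptr => .ok (.addr ⟨i, none⟩)
  | .inttoptr, .int _ v, .ptr => ptrOfInt X v.toNat
  | .bitcast, v, τ => .ok (DVal.ofBytes X τ v.toBytes)
  | _, _, _ => .err .fail

/-! ## Concretization of under-defined values -/

/-- The byte of a concretized symbolic byte. -/
def SByte.pickByte {X : Phase} (b : SByte X) (dv : DVal X) : Option CByte := dv.toBytes[b.idx]?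

mutual

/-- `Concretize uv o`: the outcome `o` belongs to the set of concretizations of `uv`. -/
inductive Concretize {X : Phase} : UVal X → Outcome (DVal X) → Prop
  | ofD (dv : DVal X) : Concretize (.ofD dv) (.ok dv)
  | array (us : List (UVal X)) (dvs : List (DVal X)) (h : ConcretizeAll us (.ok dvs)) :
      Concretize (.array us) (.ok (.array dvs))
  | arrayErr (us : List (UVal X)) (e : Err) (h : ConcretizeAll us (.err e)) :
      Concretize (.array us) (.err e)
  | undef (τ : DTyp) (dv : DVal X) (h : dv.HasTyp τ) (hp : dv ≠ .poison τ) :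
      Concretize (.undef τ) (.ok dv)
  | op (o : BinOp) (x y : UVal X) (a b : DVal X) (hx : Concretize x (.ok a))
      (hy : Concretize y (.ok b)) : Concretize (.op o x y) (o.eval a b)
  | opErrLeft (o : BinOp) (x y : UVal X) (e : Err) (hx : Concretize x (.err e)) :
      Concretize (.op o x y) (.err e)
  | opErrRight (o : BinOp) (x y : UVal X) (a : DVal X) (e : Err) (hx : Concretize x (.ok a))
      (hy : Concretize y (.err e)) : Concretize (.op o x y) (.err e)
  | conv (c : Conv) (x : UVal X) (τ : DTyp) (a : DVal X) (hx : Concretize x (.ok a)) :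
      Concretize (.conv c x τ) (c.eval a τ)
  | convErr (c : Conv) (x : UVal X) (τ : DTyp) (e : Err) (hx : Concretize x (.err e)) :
      Concretize (.conv c x τ) (.err e)
  | selectTrue (τ : DTyp) (c x y : UVal X) (o : Outcome (DVal X))
      (hc : Concretize c (.ok (.ofBool true))) (hx : Concretize x o) :
      Concretize (.select τ c x y) o
  | selectFalse (τ : DTyp) (c x y : UVal X) (o : Outcome (DVal X))
      (hc : Concretize c (.ok (.ofBool false))) (hy : Concretize y o) :
      Concretize (.select τ c x y) o
  | selectPoison (τ τ' : DTyp) (c x y : UVal X) (hc : Concretize c (.ok (.poison τ'))) :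
      Concretize (.select τ c x y) (.ok (.poison τ))
  | selectFail (τ : DTyp) (c x y : UVal X) (a : DVal X) (hc : Concretize c (.ok a))
      (ht : a ≠ .ofBool true) (hf : a ≠ .ofBool false) (hp : ∀ τ', a ≠ .poison τ') :
      Concretize (.select τ c x y) (.err .fail)
  | selectErr (τ : DTyp) (c x y : UVal X) (e : Err) (hc : Concretize c (.err e)) :
      Concretize (.select τ c x y) (.err e)
  /- Symbolic bytes that come from the same store are concretized in the same way. -/
  | concat (bs : List (SByte X)) (τ : DTyp) (dvs : List (DVal X)) (cs : List CByte)
      (h : ConcretizeAll (bs.map SByte.uv) (.ok dvs))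
      (hsid : ∀ (j k : ℕ) (bj bk : SByte X), bs[j]? = some bj → bs[k]? = some bk →
        bj.sid = bk.sid → dvs[j]? = dvs[k]?)
      (hcs : List.zipWith SByte.pickByte bs dvs = cs.map some) :
      Concretize (.concat bs τ) (.ok (DVal.ofBytes X τ cs))
  | concatFail (bs : List (SByte X)) (τ : DTyp) (dvs : List (DVal X))
      (h : ConcretizeAll (bs.map SByte.uv) (.ok dvs))
      (hsid : ∀ (j k : ℕ) (bj bk : SByte X), bs[j]? = some bj → bs[k]? = some bk →
        bj.sid = bk.sid → dvs[j]? = dvs[k]?)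
      (hcs : none ∈ List.zipWith SByte.pickByte bs dvs) :
      Concretize (.concat bs τ) (.err .fail)
  | concatErr (bs : List (SByte X)) (τ : DTyp) (e : Err)
      (h : ConcretizeAll (bs.map SByte.uv) (.err e)) : Concretize (.concat bs τ) (.err e)

/-- Concretization of the members of a list, from left to right. -/
inductive ConcretizeAll {X : Phase} : List (UVal X) → Outcome (List (DVal X)) → Prop
  | nil : ConcretizeAll [] (.ok [])
  | cons (u : UVal X) (us : List (UVal X)) (dv : DVal X) (dvs : List (DVal X))
      (h : Concretize u (.ok dv)) (hs : ConcretizeAll us (.ok dvs)) :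
      ConcretizeAll (u :: us) (.ok (dv :: dvs))
  | headErr (u : UVal X) (us : List (UVal X)) (e : Err) (h : Concretize u (.err e)) :
      ConcretizeAll (u :: us) (.err e)
  | tailErr (u : UVal X) (us : List (UVal X)) (dv : DVal X) (e : Err)
      (h : Concretize u (.ok dv)) (hs : ConcretizeAll us (.err e)) :
      ConcretizeAll (u :: us) (.err e)

end

/-! ## Memory configurations and the specification monad -/

structure Conf (X : Phase) where
  mem : X.Addr → Option (SByte X × Prov)
  heap : X.Addr → Option (Set (Ptr X))
  stack : List (Set (Ptr X))
  used : Set Prov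

/-- The state of the memory: a configuration and the next store identifier. -/
structure Mem (X : Phase) where
  conf : Conf X
  sid : ℕ

/-- Nondeterministic stateful computations that may raise errors. -/
def Spec (X : Phase) (A : Type) : Type := Mem X → Set (Outcome (Mem X × A))

namespace Spec

variable {X : Phase} {A B : Type}

def pure (a : A) : Spec X A := fun σ => {.ok (σ, a)}

def throw (e : Err) : Spec X A := fun _ => {.err e}

def bind (c : Spec X A) (f : A → Spec X B) : Spec X B := fun σ =>
  {o | (∃ e, Outcome.err e ∈ c σ ∧ o = .err e) ∨ ∃ σ' a, Outcome.ok (σ', a) ∈ c σ ∧ o ∈ f a σ'}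

/-- Run `f` on the members of a list, from left to right. -/
def traverse (f : A → Spec X B) : List A → Spec X (List B)
  | [] => pure []
  | a :: as => bind (f a) fun b => bind (traverse f as) fun bs => pure (b :: bs)

end Spec

/-- The memory `m` holds the byte `b` at the pointer `p`, and `p` has the right to access it. -/
def Holds {X : Phase} (m : X.Addr → Option (SByte X × Prov)) (p : Ptr X) (b : SByte X) : Prop :=
  ∃ pr, m p.a = some (b, pr) ∧ (p.pr = none ∨ p.pr = pr)

def Accessible {X : Phase} (m : X.Addr → Option (SByte X × Prov)) (p : Ptr X) : Prop :=
  ∃ b, Holds m p b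

/-- Two memories agree on content and provenance except at the addresses of the pointers in `ps`. -/
def AgreeOutside {X : Phase} (m₁ m₂ : X.Addr → Option (SByte X × Prov)) (ps : Set (Ptr X)) : Prop :=
  ∀ a, (∀ p ∈ ps, a ≠ p.a) → m₁ a = m₂ a

def readByte {X : Phase} (p : Ptr X) : Spec X (SByte X) := fun σ =>
  {o | (∃ b, Holds σ.conf.mem p b ∧ o = .ok (σ, b)) ∨ (¬ Accessible σ.conf.mem p ∧ o = .err .ub)}

/-- Writing a byte does not change the provenance of the memory cell. -/
def writeByte {X : Phase} (p : Ptr X) (b : SByte X) : Spec X Unit := fun σ₁ =>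
  {o | (∃ σ₂ : Mem X, o = .ok (σ₂, ()) ∧ σ₁.sid = σ₂.sid ∧ σ₁.conf.heap = σ₂.conf.heap ∧
        σ₁.conf.stack = σ₂.conf.stack ∧ σ₁.conf.used = σ₂.conf.used ∧
        Accessible σ₁.conf.mem p ∧ Holds σ₂.conf.mem p b ∧
        (σ₁.conf.mem p.a).map Prod.snd = (σ₂.conf.mem p.a).map Prod.snd ∧
        AgreeOutside σ₁.conf.mem σ₂.conf.mem {p}) ∨
      (¬ Accessible σ₁.conf.mem p ∧ o = .err .ub)}

/-- A fresh provenance, different from the wildcard. -/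
def freshProv {X : Phase} : Spec X Prov := fun σ =>
  {o | ∃ pr : Prov, pr ≠ none ∧ pr ∉ σ.conf.used ∧
    o = .ok ({ σ with conf := { σ.conf with used := {pr} ∪ σ.conf.used } }, pr)}

def freshSid {X : Phase} : Spec X ℕ := fun σ => {.ok ({ σ with sid := σ.sid + 1 }, σ.sid)}

/-- The pointers at distance `0, …, n - 1` from `p`; out of memory if one of them overflows. -/
def consecutive {X : Phase} (p : Ptr X) (n : ℕ) : Spec X (List (Ptr X)) :=
  Spec.traverse (fun i => match Addr.plus p.a i with
    | some a => Spec.pure ⟨a, p.pr⟩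
    | none => Spec.throw .oom) (List.range n)

/-- The address of a free block of `n` bytes. -/
def findFree {X : Phase} (n : ℕ) : Spec X X.Addr := fun σ =>
  {o | ∃ a : X.Addr, (∀ i < n, ∃ a', Addr.plus a i = some a' ∧ σ.conf.mem a' = none) ∧
    o = .ok (σ, a)}

def allocaPost {X : Phase} (bs : List (SByte X)) (ps : List (Ptr X)) : Spec X Unit := fun σ₁ =>
  {o | (∃ (σ₂ : Mem X) (f : Set (Ptr X)) (fs : List (Set (Ptr X))), o = .ok (σ₂, ()) ∧
        σ₁.sid = σ₂.sid ∧ σ₁.conf.heap = σ₂.conf.heap ∧ σ₁.conf.used = σ₂.conf.used ∧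
        σ₁.conf.stack = f :: fs ∧ σ₂.conf.stack = (f ∪ {p | p ∈ ps}) :: fs ∧
        List.Forall₂ (Holds σ₂.conf.mem) ps bs ∧
        AgreeOutside σ₁.conf.mem σ₂.conf.mem {p | p ∈ ps}) ∨
      (σ₁.conf.stack = [] ∧ o = .err .fail)}

/-- Allocation of a block in the current stack frame. -/
def allocaBytes {X : Phase} (bs : List (SByte X)) : Spec X (Ptr X) :=
  Spec.bind freshProv fun pr =>
  Spec.bind (findFree bs.length) fun a =>
  Spec.bind (consecutive ⟨a, pr⟩ bs.length) fun ps =>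
  Spec.bind (allocaPost bs ps) fun _ =>
  Spec.pure ⟨a, pr⟩

def pushFrame {X : Phase} : Spec X Unit := fun σ =>
  {.ok ({ σ with conf := { σ.conf with stack := ∅ :: σ.conf.stack } }, ())}

/-- `PopsTo σ₁ σ₂`: popping the topmost frame in `σ₁` results in `σ₂`. -/
def PopsTo {X : Phase} (σ₁ σ₂ : Mem X) : Prop :=
  ∃ f, σ₁.sid = σ₂.sid ∧ σ₁.conf.heap = σ₂.conf.heap ∧ σ₁.conf.used = σ₂.conf.used ∧
    σ₁.conf.stack = f :: σ₂.conf.stack ∧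
    (∀ p ∈ f, Accessible σ₁.conf.mem p ∧ σ₂.conf.mem p.a = none) ∧
    AgreeOutside σ₁.conf.mem σ₂.conf.mem f

def popFrame {X : Phase} : Spec X Unit := fun σ₁ =>
  {o | (∃ σ₂, PopsTo σ₁ σ₂ ∧ o = .ok (σ₂, ())) ∨ ((¬ ∃ σ₂, PopsTo σ₁ σ₂) ∧ o = .err .fail)}

/-- All bytes of the value `uv` of type `τ`, as written by the store `sid`. -/
def sbytes {X : Phase} (uv : UVal X) (τ : DTyp) (sid : ℕ) : List (SByte X) :=
  (List.range τ.size).map fun i => .mk τ uv i sid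

def serialize {X : Phase} (uv : UVal X) (τ : DTyp) : Spec X (List (SByte X)) :=
  Spec.bind freshSid fun sid => Spec.pure (sbytes uv τ sid)

/-- The only value of a type of size zero. -/
def emptyVal (X : Phase) : DTyp → DVal X
  | .array n τ => .array (List.replicate n (emptyVal X τ))
  | _ => .unit

/-- The value of type `τ` represented by a list of symbolic bytes. -/
def Deserializes {X : Phase} (bs : List (SByte X)) (τ : DTyp) (v : UVal X) : Prop :=
  if τ.size = 0 then v = .ofD (emptyVal X τ)
  else (∃ uv sid, bs = sbytes uv τ sid ∧ v = uv) ∨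
    ((¬ ∃ uv sid, bs = sbytes uv τ sid) ∧ v = .concat bs τ)

def deserialize {X : Phase} (bs : List (SByte X)) (τ : DTyp) : Spec X (UVal X) := fun σ =>
  {o | ∃ v, Deserializes bs τ v ∧ o = .ok (σ, v)}

def load {X : Phase} (τ : DTyp) (p : Ptr X) : Spec X (UVal X) :=
  Spec.bind (consecutive p τ.size) fun ps =>
  Spec.bind (Spec.traverse readByte ps) fun bs =>
  deserialize bs τ

def store {X : Phase} (τ : DTyp) (p : Ptr X) (uv : UVal X) : Spec X Unit :=
  Spec.bind (serialize uv τ) fun bs =>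
  Spec.bind (consecutive p τ.size) fun ps =>
  Spec.bind (Spec.traverse (fun q => writeByte q.1 q.2) (ps.zip bs)) fun _ =>
  Spec.pure ()

/-- Stack allocation of an uninitialized value of type `τ`. -/
def alloca {X : Phase} (τ : DTyp) : Spec X (Ptr X) :=
  Spec.bind (serialize (.undef τ) τ) fun bs => allocaBytes bs

/-! ## Events -/

/-- Calls of intrinsics. -/
def IntrinsicE (X : Phase) : Sig := ⟨DTyp × String × List (DVal X), fun _ => DVal X⟩

inductive GlobalOp (X : Phase)
  | write (x : String) (v : DVal X)
  | read (x : String)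

/-- Accesses to the global environment. -/
def GlobalE (X : Phase) : Sig where
  Op := GlobalOp X
  Ans := fun e => match e with
    | .write _ _ => Unit
    | .read _ => DVal X

inductive LocalOp (X : Phase)
  | write (x : String) (v : UVal X)
  | read (x : String)
  | push (args : List (String × UVal X))
  | pop

/-- Accesses to the local environment and to the stack of local environments. -/
def LocalE (X : Phase) : Sig where
  Op := LocalOp X
  Ans := fun e => match e with
    | .write _ _ => Unit
    | .read _ => UVal X
    | .push _ => Unit
    | .pop => Unit

inductive MemOp (X : Phase)
  | push
  | pop
  | load (τ : DTyp) (a : DVal X)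
  | store (τ : DTyp) (a : DVal X) (uv : UVal X)
  | alloca (τ : DTyp)

/-- Interactions with the memory model. -/
def MemE (X : Phase) : Sig where
  Op := MemOp X
  Ans := fun e => match e with
    | .push => Unit
    | .pop => Unit
    | .load _ _ => UVal X
    | .store _ _ _ => Unit
    | .alloca _ => DVal X

/-- Nondeterminism: choose a concretization, of any under-defined value, of one with a unique
concretization, and of one that cannot be poison. -/
inductive PickOp (X : Phase)
  | pick (uv : UVal X)
  | pickUnique (uv : UVal X)
  | pickNonPoison (uv : UVal X)

def PickE (X : Phase) : Sig := ⟨PickOp X, fun _ => DVal X⟩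

/-- Calls of external functions. -/
def CallE (X : Phase) : Sig := ⟨DTyp × UVal X × List (DVal X), fun _ => DVal X⟩

/-- Debugging messages. -/
def DebugE : Sig := ⟨String, fun _ => Unit⟩

/-- The events undefined behaviour, out of memory, and failure. They have no answers. -/
def ErrE : Sig := ⟨Err, fun _ => Empty⟩

abbrev E5 (X : Phase) : Sig := (CallE X).sum (DebugE.sum ErrE)
abbrev E4 (X : Phase) : Sig := (PickE X).sum (E5 X)
abbrev E3 (X : Phase) : Sig := (MemE X).sum (E4 X)
abbrev E2 (X : Phase) : Sig := (LocalE X).sum (E3 X)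
abbrev E1 (X : Phase) : Sig := (GlobalE X).sum (E2 X)
abbrev E0 (X : Phase) : Sig := (IntrinsicE X).sum (E1 X)

def err5 (X : Phase) (e : Err) : (E5 X).Op := .inr (.inr e)
def err4 (X : Phase) (e : Err) : (E4 X).Op := .inr (err5 X e)
def err3 (X : Phase) (e : Err) : (E3 X).Op := .inr (err4 X e)
def err2 (X : Phase) (e : Err) : (E2 X).Op := .inr (err3 X e)

def raise3 (X : Phase) {R : Type} (e : Err) : ITree (E3 X) R :=
  ITree.vis (err3 X e) (fun a : Empty => a.elim)

def raise2 (X : Phase) {R : Type} (e : Err) : ITree (E2 X) R :=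
  ITree.vis (err2 X e) (fun a : Empty => a.elim)

/-! ## Handlers -/

/-- The meaning of the intrinsics, as computations over the other events. -/
def Intrinsics (X : Phase) : Type :=
  (e : (IntrinsicE X).Op) → ITree (E1 X) ((IntrinsicE X).Ans e)

/-- Global environments. -/
abbrev EnvG (X : Phase) : Type := String → Option (DVal X)

/-- One frame of local variables. -/
abbrev Locals (X : Phase) : Type := String → Option (UVal X)

/-- Local environments: the current frame and the stack of the suspended frames. -/
abbrev EnvL (X : Phase) : Type := Locals X × List (Locals X)

def handleGlobal (X : Phase) (e : (GlobalE X).Op) (g : EnvG X) :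
    ITree (E2 X) (EnvG X × (GlobalE X).Ans e) :=
  match e with
  | .write x v => ITree.ret (Function.update g x (some v), ())
  | .read x => match g x with
    | some v => ITree.ret (g, v)
    | none => raise2 X .fail

/-- The frame of a called function. -/
def Locals.ofArgs {X : Phase} : List (String × UVal X) → Locals X
  | [] => fun _ => none
  | (x, v) :: args => Function.update (Locals.ofArgs args) x (some v)

def handleLocal (X : Phase) (e : (LocalE X).Op) (l : EnvL X) :
    ITree (E3 X) (EnvL X × (LocalE X).Ans e) :=
  match e with
  | .write x v => ITree.ret ((Function.update l.1 x (some v), l.2), ())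
  | .read x => match l.1 x with
    | some v => ITree.ret (l, v)
    | none => raise3 X .fail
  | .push args => ITree.ret ((Locals.ofArgs args, l.1 :: l.2), ())
  | .pop => match l.2 with
    | f :: fs => ITree.ret ((f, fs), ())
    | [] => raise3 X .fail

/-- The specification of the memory events: accesses through something that is not an address are
undefined behaviour. -/
def memSpec (X : Phase) (e : (MemE X).Op) : Spec X ((MemE X).Ans e) :=
  match e with
  | .push => pushFrame
  | .pop => popFrame
  | .load τ a => match a with
    | .addr p => load τ p
    | _ => Spec.throw .ub
  | .store τ a uv => match a with
    | .addr p => store τ p uv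
    | _ => Spec.throw .ub
  | .alloca τ => Spec.bind (alloca τ) fun p => Spec.pure (DVal.addr p)

/-- Every memory operation may run out of memory. -/
def handleMem (X : Phase) (e : (MemE X).Op) (σ : Mem X) : Set (Outcome (Mem X × (MemE X).Ans e)) :=
  memSpec X e σ ∪ {.err .oom}

def UVal.Unique {X : Phase} (uv : UVal X) : Prop :=
  ∃ dv, ∀ dv', Concretize uv (.ok dv') → dv' = dv

def UVal.NonPoison {X : Phase} (uv : UVal X) : Prop :=
  ∀ τ, ¬ Concretize uv (.ok (.poison τ))

/-- The concretizations of an under-defined value, as outcomes of a stateless computation. -/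
def UVal.outcomes {X : Phase} (uv : UVal X) : Set (Outcome (Unit × DVal X)) :=
  {o | (∃ dv, Concretize uv (.ok dv) ∧ o = .ok ((), dv)) ∨
    ∃ e, Concretize uv (.err e) ∧ o = .err e}

/-- The specification of the nondeterminism events. A violated constraint is undefined
behaviour. -/
def handlePick (X : Phase) (e : (PickE X).Op) (_ : Unit) :
    Set (Outcome (Unit × (PickE X).Ans e)) :=
  match e with
  | .pick uv => uv.outcomes
  | .pickUnique uv => {o | (uv.Unique ∧ o ∈ uv.outcomes) ∨ (¬ uv.Unique ∧ o = .err .ub)}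
  | .pickNonPoison uv => {o | (uv.NonPoison ∧ o ∈ uv.outcomes) ∨ (¬ uv.NonPoison ∧ o = .err .ub)}

/-! ## Levels of interpretation -/

/-- Results after the interpretation of the global environment, of the local environment, and of
the memory. -/
abbrev Res2 (X : Phase) : Type := EnvG X × DVal X
abbrev Res3 (X : Phase) : Type := EnvL X × Res2 X
abbrev Res4 (X : Phase) : Type := Mem X × Res3 X

/-- Results are compared by their values; environments and memories are ignored. -/
def EqRes2 {X : Phase} (r r' : Res2 X) : Prop := r.2 = r'.2
def EqRes3 {X : Phase} (r r' : Res3 X) : Prop := EqRes2 r.2 r'.2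
def EqRes4 {X : Phase} (r r' : Res4 X) : Prop := EqRes3 r.2 r'.2

/-- The tree may reach undefined behaviour. -/
inductive HasUB {X : Phase} {R : Type} : ITree (E5 X) R → Prop
  | here (t : ITree (E5 X) R) (k : (E5 X).Ans (err5 X .ub) → ITree (E5 X) R)
      (h : t.observe = .vis (err5 X .ub) k) : HasUB t
  | tau (t t' : ITree (E5 X) R) (h : t.observe = .tau t') (h' : HasUB t') : HasUB t
  | vis (t : ITree (E5 X) R) (e : (E5 X).Op) (k : (E5 X).Ans e → ITree (E5 X) R)
      (h : t.observe = .vis e k) (a : (E5 X).Ans e) (h' : HasUB (k a)) : HasUB t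

/-- The tree is the out-of-memory event. -/
def IsOOM {X : Phase} {R : Type} (u : ITree (E5 X) R) : Prop :=
  ∃ k, u.observe = .vis (err5 X .oom) k

/-- Weak simulation in which an out-of-memory event on the right is related to any tree on the
left. -/
def EuttOOM {X : Phase} {R R' : Type} (RR : R → R' → Prop) (t : ITree (E5 X) R)
    (u : ITree (E5 X) R') : Prop :=
  ITree.WeakSim RR IsOOM t u

/-- The initial global environment, local environment and memory. -/
structure Start (X : Phase) where
  g : EnvG X
  l : EnvL X
  m : Mem X

/-- The behaviours at each level of interpretation: initially (0), after the interpretation of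
intrinsics (1), of the global environment (2), of the local environment (3), of the memory (4), of
nondeterminism (5), of undefined behaviour (6), and of out of memory (7), which is the top level. -/
def BehaviourAt (X : Phase) : ℕ → Type
  | 0 => ITree (E0 X) (DVal X)
  | 1 => ITree (E1 X) (DVal X)
  | 2 => ITree (E2 X) (Res2 X)
  | 3 => ITree (E3 X) (Res3 X)
  | 4 => Set (ITree (E4 X) (Res4 X))
  | _ + 5 => Set (ITree (E5 X) (Res4 X))

/-- All behaviours of a tree under the specification of the memory. -/
def modelMem (X : Phase) (m : Mem X) (t : ITree (E3 X) (Res3 X)) : Set (ITree (E4 X) (Res4 X)) :=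
  {u | ITree.Runs (err4 X) (handleMem X) Prod.mk t m u}

/-- All behaviours of a set of trees under the specification of nondeterminism. -/
def modelPick (X : Phase) (P : Set (ITree (E4 X) (Res4 X))) : Set (ITree (E5 X) (Res4 X)) :=
  {u | ∃ t ∈ P, ITree.Runs (err5 X) (handlePick X) (fun _ r => r) t () u}

/-- If undefined behaviour is possible, then every behaviour is. -/
def modelUB (X : Phase) (P : Set (ITree (E5 X) (Res4 X))) : Set (ITree (E5 X) (Res4 X)) :=
  {u | u ∈ P ∨ ∃ t ∈ P, HasUB t}

/-- Every behaviour may stop with an out-of-memory event. -/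
def modelOOM (X : Phase) (P : Set (ITree (E5 X) (Res4 X))) : Set (ITree (E5 X) (Res4 X)) :=
  {u | ∃ t ∈ P, EuttOOM Eq t u}

/-- One step of interpretation. -/
def interpStep {X : Phase} (I : Intrinsics X) (s : Start X) :
    (n : ℕ) → BehaviourAt X n → BehaviourAt X (n + 1)
  | 0, t => ITree.interp I t
  | 1, t => ITree.interpState (handleGlobal X) t s.g
  | 2, t => ITree.interpState (handleLocal X) t s.l
  | 3, t => modelMem X s.m t
  | 4, P => modelPick X P
  | 5, P => modelUB X P
  | 6, P => modelOOM X P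
  | _ + 7, P => P

/-- Refinement after the interpretation of nondeterminism, of undefined behaviour, and at the top
level: `P` is refined by `Q`. -/
def RefinesPick {X : Phase} (P Q : Set (ITree (E5 X) (Res4 X))) : Prop :=
  ∀ t' ∈ Q, ∃ t ∈ P, ITree.Eutt EqRes4 t t'

def RefinesUB {X : Phase} (P Q : Set (ITree (E5 X) (Res4 X))) : Prop :=
  ∀ t' ∈ Q, ∃ t ∈ P, HasUB t ∨ ITree.Eutt EqRes4 t t'

def RefinesVIR {X : Phase} (P Q : Set (ITree (E5 X) (Res4 X))) : Prop :=
  ∀ t' ∈ Q, ∃ t ∈ P, HasUB t ∨ EuttOOM EqRes4 t t'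

/-- Refinement after the interpretation of the memory. -/
def RefinesMem {X : Phase} (P Q : Set (ITree (E4 X) (Res4 X))) : Prop :=
  ∀ t' ∈ Q, ∃ t ∈ P, ITree.Eutt EqRes4 t t'

def RefinesAt (X : Phase) : (n : ℕ) → BehaviourAt X n → BehaviourAt X n → Prop
  | 0, P, Q => ITree.Eutt (E := E0 X) (R := DVal X) Eq P Q
  | 1, P, Q => ITree.Eutt (E := E1 X) (R := DVal X) Eq P Q
  | 2, P, Q => ITree.Eutt (E := E2 X) EqRes2 P Q
  | 3, P, Q => ITree.Eutt (E := E3 X) EqRes3 P Q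
  | 4, P, Q => RefinesMem P Q
  | 5, P, Q => RefinesPick P Q
  | 6, P, Q => RefinesUB P Q
  | _ + 7, P, Q => RefinesVIR P Q

/-- The levels of interpretation. -/
abbrev Level : Type := Fin 8

abbrev Level.top : Level := 7

abbrev Behaviour (X : Phase) (ℓ : Level) : Type := BehaviourAt X ℓ.val

/-- `Refines ℓ P Q`: at the level `ℓ`, the behaviour `P` is refined by the behaviour `Q`. -/
abbrev Refines {X : Phase} (ℓ : Level) (P Q : Behaviour X ℓ) : Prop := RefinesAt X ℓ.val P Q

/-- Interpretation of a behaviour at level `ℓ` down to the level `ℓ'`. -/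
def interpTo {X : Phase} (I : Intrinsics X) (s : Start X) {ℓ ℓ' : Level} (h : ℓ ≤ ℓ')
    (P : Behaviour X ℓ) : Behaviour X ℓ' :=
  Nat.leRecOn (C := BehaviourAt X) (Fin.le_def.mp h) (fun {n} => interpStep I s n) P

end VIR

/-!
Refinement is preserved by each single interpretation step, hence, by induction on the number of
steps, by interpretation between any two levels.

* The handlers of the intrinsics and of the environments are interpreted by `interp` and
  `interpState`. Equivalent trees run the same handler computations from the same states, so
  interpretation preserves `Eutt` (`eutt_interpState`, `eutt_interp`). The coinductive invariant
  relates two interpreters that are in the midst of the *same* handler computation, whose results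
  are continued by equivalent trees.
* The memory and the nondeterminism are interpreted by sets of trees, `Runs`. If `t` is equivalent
  to `t'`, every run of `t'` can be replayed by `t` (`Runs.exists_of_eutt`): whenever `t` performs
  an event, `t'` performs the same event after finitely many silent steps, and `t` takes the outcome
  that the given run of `t'` takes there. The replayed run is built by corecursion, its layers being
  chosen by `exists_layer`. The silent steps of the two sides are consumed in pairs as long as both
  sides have one, which makes the replayed run equivalent to the given one even when it diverges.
* Undefined behaviour is invariant under equivalence (`HasUB.of_eutt`), and out of memory is dealt
  with by the transitivity of the simulations (`WeakSim.trans`).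
-/

namespace VIR

namespace ITree

variable {E F H : Sig} {R R' R'' S T T' : Type}

/-! ### Weak simulations -/

theorem WeakSimF.mono {RR SS : R → R' → Prop} {cut cut' : ITree E R' → Prop}
    {sim sim' : ITree E R → ITree E R' → Prop} (hR : ∀ a b, RR a b → SS a b)
    (hc : ∀ u, cut u → cut' u) (hs : ∀ t u, sim t u → sim' t u) {t : ITree E R} {u : ITree E R'}
    (h : WeakSimF RR cut sim t u) : WeakSimF SS cut' sim' t u := by
  induction h with
  | ret a b ht hu hab => exact .ret a b ht hu (hR _ _ hab)
  | tau t' u' ht hu h => exact .tau t' u' ht hu (hs _ _ h)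
  | vis e k k' ht hu h => exact .vis e k k' ht hu fun a => hs _ _ (h a)
  | tauL t' ht _ ih => exact .tauL t' ht ih
  | tauR u' hu _ ih => exact .tauR u' hu ih
  | cut hu => exact .cut (hc _ hu)

theorem WeakSim.mono {RR SS : R → R' → Prop} {cut cut' : ITree E R' → Prop}
    (hR : ∀ a b, RR a b → SS a b) (hc : ∀ u, cut u → cut' u) {t : ITree E R} {u : ITree E R'} :
    WeakSim RR cut t u → WeakSim SS cut' t u
  | ⟨sim, hsim, h⟩ => ⟨sim, fun t u h => (hsim t u h).mono hR hc fun _ _ h => h, h⟩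

section

variable {RR : R → R' → Prop} {cut : ITree E R' → Prop} {t t' : ITree E R} {u u' : ITree E R'}

theorem WeakSim.dest : WeakSim RR cut t u → WeakSimF RR cut (WeakSim RR cut) t u
  | ⟨sim, hsim, h⟩ =>
    (hsim t u h).mono (fun _ _ h => h) (fun _ h => h) fun _ _ h => ⟨sim, hsim, h⟩

theorem WeakSim.of_weakSimF (h : WeakSimF RR cut (WeakSim RR cut) t u) : WeakSim RR cut t u :=
  ⟨WeakSimF RR cut (WeakSim RR cut),
    fun _ _ h => h.mono (fun _ _ h => h) (fun _ h => h) fun _ _ h => h.dest, h⟩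

/-- A silent step on the left of a weak simulation can be undone. -/
theorem WeakSim.of_tau_left (ht : observe t = .tau t') (h : WeakSim RR cut t u) :
    WeakSim RR cut t' u := by
  have hF := h.dest
  clear h
  induction hF with
  | ret a b ht' => rw [ht] at ht'; cases ht'
  | tau t₁ u₁ ht' hu h =>
    rw [ht] at ht'
    cases ht'
    exact .of_weakSimF (.tauR u₁ hu h.dest)
  | vis e k k' ht' => rw [ht] at ht'; cases ht'
  | tauL t₁ ht' h =>
    rw [ht] at ht'
    cases ht'
    exact .of_weakSimF h
  | tauR u₁ hu _ ih => exact .of_weakSimF (.tauR u₁ hu (ih ht).dest)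
  | cut hu => exact .of_weakSimF (.cut hu)

theorem WeakSim.refl (RR : R → R → Prop) (cut : ITree E R → Prop) (hR : ∀ r, RR r r)
    (t : ITree E R) : WeakSim RR cut t t := by
  refine ⟨Eq, ?_, rfl⟩
  rintro t _ rfl
  cases h : observe t with
  | ret r => exact .ret r r h h (hR r)
  | tau t' => exact .tau t' t' h h rfl
  | vis e k => exact .vis e k k h h fun _ => rfl

theorem Eutt.symm (h : Eutt RR t u) : Eutt (fun b a => RR a b) u t := by
  obtain ⟨sim, hsim, h⟩ := h
  refine ⟨fun u t => sim t u, fun u t h => ?_, h⟩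
  have hF := hsim t u h
  clear h
  induction hF with
  | ret a b ht hu hab => exact .ret b a hu ht hab
  | tau t' u' ht hu h => exact .tau u' t' hu ht h
  | vis e k k' ht hu h => exact .vis e k' k hu ht h
  | tauL t' ht _ ih => exact .tauR t' ht ih
  | tauR u' hu _ ih => exact .tauL u' hu ih
  | cut hu => exact hu.elim

theorem Eutt.of_tau_right (hu : observe u = .tau u') (h : Eutt RR t u) : Eutt RR t u' :=
  Eutt.symm (WeakSim.of_tau_left hu h.symm)

end

/-! ### Finitely many silent steps -/

/-- `Taus t t'`: finitely many silent steps lead from `t` to `t'`. -/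
def Taus : ITree E R → ITree E R → Prop :=
  Relation.ReflTransGen fun t t' => observe t = .tau t'

/-- `Converges t`: after finitely many silent steps, `t` returns or performs an event. -/
def Converges (t : ITree E R) : Prop :=
  ∃ t', Taus t t' ∧ ∀ t'', observe t' ≠ .tau t''

section

variable {RR : R → R' → Prop} {cut : ITree E R' → Prop}
  {sim : ITree E R → ITree E R' → Prop} {t t' : ITree E R} {u u' : ITree E R'}

theorem WeakSimF.taus_left (h : Taus t t') (hF : WeakSimF RR cut sim t' u) :
    WeakSimF RR cut sim t u := by
  induction h using Relation.ReflTransGen.head_induction_on with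
  | refl => exact hF
  | head h _ ih => exact .tauL _ h ih

theorem WeakSimF.taus_right (h : Taus u u') (hF : WeakSimF RR cut sim t u') :
    WeakSimF RR cut sim t u := by
  induction h using Relation.ReflTransGen.head_induction_on with
  | refl => exact hF
  | head h _ ih => exact .tauR _ h ih

theorem WeakSim.of_taus_left (h : Taus t t') (hs : WeakSim RR cut t u) :
    WeakSim RR cut t' u := by
  induction h with
  | refl => exact hs
  | tail _ h ih => exact ih.of_tau_left h

theorem WeakSim.exists_of_ret {a : R} (ht : observe t = .ret a) (h : WeakSim RR cut t u) :
    ∃ u', Taus u u' ∧ ((∃ b, observe u' = .ret b ∧ RR a b) ∨ cut u') := by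
  have hF := h.dest
  clear h
  induction hF with
  | ret a' b ht' hu hab =>
    rw [ht] at ht'
    cases ht'
    exact ⟨_, .refl, .inl ⟨b, hu, hab⟩⟩
  | tau t' u' ht' => rw [ht] at ht'; cases ht'
  | vis e k k' ht' => rw [ht] at ht'; cases ht'
  | tauL t' ht' => rw [ht] at ht'; cases ht'
  | tauR u' hu _ ih =>
    obtain ⟨u₁, h₁, h₂⟩ := ih ht
    exact ⟨u₁, .head hu h₁, h₂⟩
  | cut hu => exact ⟨_, .refl, .inr hu⟩

theorem WeakSim.exists_of_vis {e : E.Op} {k : E.Ans e → ITree E R} (ht : observe t = .vis e k)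
    (h : WeakSim RR cut t u) :
    ∃ u', Taus u u' ∧
      ((∃ k', observe u' = .vis e k' ∧ ∀ a, WeakSim RR cut (k a) (k' a)) ∨ cut u') := by
  have hF := h.dest
  clear h
  induction hF with
  | ret a b ht' => rw [ht] at ht'; cases ht'
  | tau t' u' ht' => rw [ht] at ht'; cases ht'
  | vis e' k₁ k' ht' hu h =>
    rw [ht] at ht'
    cases ht'
    exact ⟨_, .refl, .inl ⟨k', hu, h⟩⟩
  | tauL t' ht' => rw [ht] at ht'; cases ht'
  | tauR u' hu _ ih =>
    obtain ⟨u₁, h₁, h₂⟩ := ih ht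
    exact ⟨u₁, .head hu h₁, h₂⟩
  | cut hu => exact ⟨_, .refl, .inr hu⟩

theorem Eutt.exists_of_ret {a : R} (ht : observe t = .ret a) (h : Eutt RR t u) :
    ∃ u', Taus u u' ∧ ∃ b, observe u' = .ret b ∧ RR a b := by
  obtain ⟨u', hu, h | h⟩ := WeakSim.exists_of_ret ht h
  · exact ⟨u', hu, h⟩
  · exact h.elim

theorem Eutt.exists_of_vis {e : E.Op} {k : E.Ans e → ITree E R} (ht : observe t = .vis e k)
    (h : Eutt RR t u) :
    ∃ u', Taus u u' ∧ ∃ k', observe u' = .vis e k' ∧ ∀ a, Eutt RR (k a) (k' a) := by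
  obtain ⟨u', hu, h | h⟩ := WeakSim.exists_of_vis ht h
  · exact ⟨u', hu, h⟩
  · exact h.elim

theorem Eutt.converges (h : Eutt RR t u) (hu : ∀ u', observe u ≠ .tau u') : Converges t := by
  cases hu' : observe u with
  | ret b =>
    obtain ⟨t', ht, a, ha, _⟩ := h.symm.exists_of_ret hu'
    exact ⟨t', ht, by simp [ha]⟩
  | tau u' => exact absurd hu' (hu u')
  | vis e k =>
    obtain ⟨t', ht, k', hk, _⟩ := h.symm.exists_of_vis hu'
    exact ⟨t', ht, by simp [hk]⟩

end

theorem WeakSim.trans {RR : R → R' → Prop} {SS : R' → R'' → Prop} {TT : R → R'' → Prop}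
    (hT : ∀ a b c, RR a b → SS b c → TT a c) {cut : ITree E R'' → Prop} {t : ITree E R}
    {u : ITree E R'} {v : ITree E R''} (h₁ : Eutt RR t u) (h₂ : WeakSim SS cut u v) :
    WeakSim TT cut t v := by
  refine ⟨fun t v => ∃ u, Eutt RR t u ∧ WeakSim SS cut u v, ?_, u, h₁, h₂⟩
  rintro t v ⟨u, h₁, h₂⟩
  -- When `t` is not a silent step, its first layer is reached on the other sides after finitely
  -- many silent steps.
  cases ht : observe t with
  | ret a =>
    obtain ⟨u₁, hu, b, hb, hab⟩ := h₁.exists_of_ret ht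
    obtain ⟨v₁, hv, ⟨c, hc, hbc⟩ | hv'⟩ := (h₂.of_taus_left hu).exists_of_ret hb
    · exact .taus_right hv (.ret a c ht hc (hT _ _ _ hab hbc))
    · exact .taus_right hv (.cut hv')
  | vis e k =>
    obtain ⟨u₁, hu, k₁, hk₁, hk⟩ := h₁.exists_of_vis ht
    obtain ⟨v₁, hv, ⟨k₂, hk₂, hk'⟩ | hv'⟩ := (h₂.of_taus_left hu).exists_of_vis hk₁
    · exact .taus_right hv (.vis e k k₂ ht hk₂ fun a => ⟨k₁ a, hk a, hk' a⟩)
    · exact .taus_right hv (.cut hv')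
  | tau t' =>
    have hF := h₂.dest
    clear h₂
    induction hF with
    | ret b c hb hc hbc =>
      obtain ⟨t₁, ht₁, a, ha, hab⟩ := h₁.symm.exists_of_ret hb
      exact .taus_left ht₁ (.ret a c ha hc (hT _ _ _ hab hbc))
    | tau u' v' hu hv h =>
      exact .tau t' v' ht hv ⟨u', Eutt.of_tau_right hu (WeakSim.of_tau_left ht h₁), h⟩
    | vis e k k' hk hk' h =>
      obtain ⟨t₁, ht₁, k₁, hk₁, hkk⟩ := h₁.symm.exists_of_vis hk
      exact .taus_left ht₁ (.vis e k₁ k' hk₁ hk' fun a => ⟨k a, (hkk a).symm, h a⟩)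
    | tauL u' hu _ ih => exact ih (h₁.of_tau_right hu)
    | tauR v' hv _ ih => exact .tauR v' hv (ih h₁)
    | cut hv => exact .cut hv

/-! ### Interpretation by handlers -/

section

variable {f : S → Step E R S} {s s' : S}

theorem observe_unfold_ret {r : R} (h : f s = .ret r) : observe (unfold f s) = .ret r := by
  rw [observe_unfold, h]

theorem observe_unfold_tau (h : f s = .tau s') :
    observe (unfold f s) = .tau (unfold f s') := by
  rw [observe_unfold, h]

theorem observe_unfold_vis {e : E.Op} {k : E.Ans e → S} (h : f s = .vis e k) :
    observe (unfold f s) = .vis e fun a => unfold f (k a) := by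
  rw [observe_unfold, h]

end

section

variable {g : R → R'} {t t' : ITree E R}

theorem observe_map_ret {r : R} (h : observe t = .ret r) : observe (map g t) = .ret (g r) :=
  observe_unfold_ret (by simp [h])

theorem observe_map_tau (h : observe t = .tau t') : observe (map g t) = .tau (map g t') :=
  observe_unfold_tau (by simp [h])

theorem observe_map_vis {e : E.Op} {k : E.Ans e → ITree E R} (h : observe t = .vis e k) :
    observe (map g t) = .vis e fun a => map g (k a) :=
  observe_unfold_vis (by simp [h])

end

theorem eutt_map {RR : R → R' → Prop} {SS : T → T' → Prop} {g : R → T} {g' : R' → T'}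
    (hg : ∀ a b, RR a b → SS (g a) (g' b)) {t : ITree E R} {u : ITree E R'} (h : Eutt RR t u) :
    Eutt SS (map g t) (map g' u) := by
  refine ⟨fun x y => ∃ t u, Eutt RR t u ∧ x = map g t ∧ y = map g' u, ?_,
    t, u, h, rfl, rfl⟩
  rintro _ _ ⟨t, u, h, rfl, rfl⟩
  have hF := WeakSim.dest h
  clear h
  induction hF with
  | ret a b ht hu hab => exact .ret _ _ (observe_map_ret ht) (observe_map_ret hu) (hg _ _ hab)
  | tau t' u' ht hu h =>
    exact .tau _ _ (observe_map_tau ht) (observe_map_tau hu) ⟨t', u', h, rfl, rfl⟩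
  | vis e k k' ht hu h =>
    exact .vis e _ _ (observe_map_vis ht) (observe_map_vis hu) fun a => ⟨_, _, h a, rfl, rfl⟩
  | tauL t' ht _ ih => exact .tauL _ (observe_map_tau ht) ih
  | tauR u' hu _ ih => exact .tauR _ (observe_map_tau hu) ih
  | cut hu => exact hu.elim

/-- The corecursion of `interpState`, started in the midst of a handler computation that returns the
next state and the tree that is still to be interpreted. -/
def interpFrom (h : (e : H.Op) → S → ITree F (S × H.Ans e)) :
    ITree F (S × ITree (H.sum F) R) → ITree F (S × R) :=
  unfold fun u => match observe u with
    | .tau u' => .tau u'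
    | .vis f k => .vis f k
    | .ret (s, t) => match observe t with
      | .ret r => .ret (s, r)
      | .tau t' => .tau (ret (s, t'))
      | .vis (.inl e) k => .tau (map (fun p : S × H.Ans e => (p.1, k p.2)) (h e s))
      | .vis (.inr f) k => .vis f (fun a => ret (s, k a))

section

variable {h : (e : H.Op) → S → ITree F (S × H.Ans e)} {c c' : ITree F (S × ITree (H.sum F) R)}
  {s : S} {t : ITree (H.sum F) R}

theorem observe_interpFrom_tau (hc : observe c = .tau c') :
    observe (interpFrom h c) = .tau (interpFrom h c') :=
  observe_unfold_tau (by simp [hc])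

theorem observe_interpFrom_vis {f : F.Op} {k : F.Ans f → ITree F (S × ITree (H.sum F) R)}
    (hc : observe c = .vis f k) :
    observe (interpFrom h c) = .vis f fun a => interpFrom h (k a) :=
  observe_unfold_vis (by simp [hc])

theorem observe_interpFrom_ret {r : R} (hc : observe c = .ret (s, t)) (ht : observe t = .ret r) :
    observe (interpFrom h c) = .ret (s, r) :=
  observe_unfold_ret (by simp [hc, ht])

theorem observe_interpFrom_ret_tau {t' : ITree (H.sum F) R} (hc : observe c = .ret (s, t))
    (ht : observe t = .tau t') :
    observe (interpFrom h c) = .tau (interpFrom h (ret (s, t'))) :=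
  observe_unfold_tau (by simp [hc, ht])

theorem observe_interpFrom_ret_inl {e : H.Op} {k : H.Ans e → ITree (H.sum F) R}
    (hc : observe c = .ret (s, t)) (ht : observe t = .vis (.inl e) k) :
    observe (interpFrom h c) =
      .tau (interpFrom h (map (fun p : S × H.Ans e => (p.1, k p.2)) (h e s))) :=
  observe_unfold_tau (by rw [hc]; dsimp only; rw [ht])

theorem observe_interpFrom_ret_inr {f : F.Op} {k : F.Ans f → ITree (H.sum F) R}
    (hc : observe c = .ret (s, t)) (ht : observe t = .vis (.inr f) k) :
    observe (interpFrom h c) = .vis f fun a => interpFrom h (ret (s, k a)) :=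
  observe_unfold_vis (by rw [hc]; dsimp only; rw [ht])

end

theorem fold_observe (t : ITree E R) : fold (observe t) = t := by
  have h : ∀ x : PFunctor.Obj ⟨Shape E R, Shape.Arity⟩ (ITree E R), (Step.ofObj x).toObj = x := by
    rintro ⟨_ | _ | _, k⟩
    · exact congrArg (Sigma.mk _) (funext fun x => Empty.elim x)
    · rfl
    · rfl
  exact (congrArg PFunctor.M.mk (h _)).trans (PFunctor.M.mk_dest t)

theorem map_ret (g : R → R') (r : R) : map g (ret r : ITree E R) = ret (g r) := by
  have h : observe (map g (ret r : ITree E R)) = .ret (g r) := observe_map_ret (observe_fold _)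
  rw [← fold_observe (map g _), h]
  rfl

theorem eutt_interpState {RR : R → R' → Prop} (h : (e : H.Op) → S → ITree F (S × H.Ans e))
    {t : ITree (H.sum F) R} {u : ITree (H.sum F) R'} (htu : Eutt RR t u) (s : S) :
    Eutt (fun p q => RR p.2 q.2) (interpState h t s) (interpState h u s) := by
  -- Both sides are in the midst of the handler computation `d`, whose result `x` gives the same
  -- state and equivalent rests `(f x).2` and `(f' x).2`.
  let sim (x : ITree F (S × R)) (y : ITree F (S × R')) : Prop :=
    ∃ (D : Type) (d : ITree F D) (f : D → S × ITree (H.sum F) R) (f' : D → S × ITree (H.sum F) R'),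
      (∀ x, (f x).1 = (f' x).1 ∧ Eutt RR (f x).2 (f' x).2) ∧
        x = interpFrom h (map f d) ∧ y = interpFrom h (map f' d)
  have sim_ret (s : S) (t : ITree (H.sum F) R) (u : ITree (H.sum F) R') (htu : Eutt RR t u) :
      sim (interpFrom h (ret (s, t))) (interpFrom h (ret (s, u))) :=
    ⟨Unit, ret (), fun _ => (s, t), fun _ => (s, u), fun _ => ⟨rfl, htu⟩,
      by rw [map_ret], by rw [map_ret]⟩
  refine ⟨sim, ?_, sim_ret s t u htu⟩
  rintro _ _ ⟨D, d, f, f', hf, rfl, rfl⟩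
  cases hd : observe d with
  | tau d' =>
    exact .tau _ _ (observe_interpFrom_tau (observe_map_tau hd))
      (observe_interpFrom_tau (observe_map_tau hd)) ⟨D, d', f, f', hf, rfl, rfl⟩
  | vis e k =>
    exact .vis e _ _ (observe_interpFrom_vis (observe_map_vis hd))
      (observe_interpFrom_vis (observe_map_vis hd)) fun a => ⟨D, k a, f, f', hf, rfl, rfl⟩
  | ret x =>
    have hc := observe_map_ret (g := f) hd
    have hc' := observe_map_ret (g := f') hd
    obtain ⟨hs, htu⟩ := hf x
    revert hc hc' hs htu
    generalize map f d = c, map f' d = c', f x = p, f' x = q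
    obtain ⟨s, t⟩ := p
    obtain ⟨s', u⟩ := q
    rintro hc hc' (rfl : s = s') (htu : Eutt RR t u)
    have hF := WeakSim.dest htu
    clear htu
    induction hF generalizing c c' with
    | ret a b ht hu hab =>
      exact .ret _ _ (observe_interpFrom_ret hc ht) (observe_interpFrom_ret hc' hu) hab
    | tau t' u' ht hu h =>
      exact .tau _ _ (observe_interpFrom_ret_tau hc ht) (observe_interpFrom_ret_tau hc' hu)
        (sim_ret s t' u' h)
    | vis e k k' ht hu h' =>
      rcases e with e | e
      · exact .tau _ _ (observe_interpFrom_ret_inl hc ht) (observe_interpFrom_ret_inl hc' hu)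
          ⟨_, h e s, fun p => (p.1, k p.2), fun p => (p.1, k' p.2), fun p => ⟨rfl, h' p.2⟩,
            rfl, rfl⟩
      · exact .vis e _ _ (observe_interpFrom_ret_inr hc ht) (observe_interpFrom_ret_inr hc' hu)
          fun a => sim_ret s _ _ (h' a)
    | tauL t' ht _ ih =>
      exact .tauL _ (observe_interpFrom_ret_tau hc ht) (ih _ _ (observe_fold _) hc')
    | tauR u' hu _ ih =>
      exact .tauR _ (observe_interpFrom_ret_tau hc' hu) (ih _ _ hc (observe_fold _))
    | cut hu => exact hu.elim

theorem eutt_interp {RR : R → R' → Prop} (h : (e : H.Op) → ITree F (H.Ans e))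
    {t : ITree (H.sum F) R} {u : ITree (H.sum F) R'} (htu : Eutt RR t u) :
    Eutt RR (interp h t) (interp h u) :=
  eutt_map (g := Prod.snd) (g' := Prod.snd) (fun _ _ h => h) (eutt_interpState _ htu ())

/-! ### Interpretation by nondeterministic specifications -/

section

variable {raise : Err → F.Op} {h : (e : H.Op) → S → Set (Outcome (S × H.Ans e))}
  {out : S → R → R'}

theorem RunsF.mono {sim sim' : ITree (H.sum F) R → S → ITree F R' → Prop}
    (hs : ∀ t s u, sim t s u → sim' t s u) {t : ITree (H.sum F) R} {s : S} {u : ITree F R'}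
    (hF : RunsF raise h out sim t s u) : RunsF raise h out sim' t s u := by
  cases hF with
  | ret r ht hu => exact .ret r ht hu
  | tau t' u' ht hu h => exact .tau t' u' ht hu (hs _ _ _ h)
  | keep f k k' ht hu h => exact .keep f k k' ht hu fun a => hs _ _ _ (h a)
  | ok e k s' a u' ht he hu h => exact .ok e k s' a u' ht he hu (hs _ _ _ h)
  | err e k x k' ht he hu => exact .err e k x k' ht he hu

variable {t t' : ITree (H.sum F) R} {s : S} {u : ITree F R'}

theorem Runs.dest : Runs raise h out t s u → RunsF raise h out (Runs raise h out) t s u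
  | ⟨sim, hsim, hr⟩ => (hsim t s u hr).mono fun _ _ _ hr => ⟨sim, hsim, hr⟩

theorem Runs.exists_of_tau (ht : observe t = .tau t') (hr : Runs raise h out t s u) :
    ∃ u', observe u = .tau u' ∧ Runs raise h out t' s u' := by
  cases hr.dest with
  | tau t₁ u' ht' hu h =>
    rw [ht] at ht'
    cases ht'
    exact ⟨u', hu, h⟩
  | ret r ht' => rw [ht] at ht'; cases ht'
  | keep f k k' ht' => rw [ht] at ht'; cases ht'
  | ok e k s' a u' ht' => rw [ht] at ht'; cases ht'
  | err e k x k' ht' => rw [ht] at ht'; cases ht'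

theorem Runs.exists_of_taus (ht : Taus t t') (hr : Runs raise h out t s u) :
    ∃ u', Taus u u' ∧ Runs raise h out t' s u' := by
  induction ht with
  | refl => exact ⟨u, .refl, hr⟩
  | tail _ ht ih =>
    obtain ⟨u₁, hu₁, hr₁⟩ := ih
    obtain ⟨u₂, hu₂, hr₂⟩ := hr₁.exists_of_tau ht
    exact ⟨u₂, .tail hu₁ hu₂, hr₂⟩

end

section

variable (RR : R → R' → Prop) (raise : Err → F.Op)
  (h : (e : H.Op) → S → Set (Outcome (S × H.Ans e))) (out : S → R → T) (out' : S → R' → T')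

/-- `u` is a run of a tree equivalent to `t`, started in the state `s`. -/
def RunsUpTo (t : ITree (H.sum F) R) (s : S) (u : ITree F T') : Prop :=
  ∃ t', Eutt RR t t' ∧ Runs raise h out' t' s u

/-- The admissible first layers of a run of `t`, started in the state `s`, that follows a given run
`u` of an equivalent tree. The layer leads to the next tree, state and run to be followed. Silent
steps of `t` without a counterpart in `u` are admitted only if `t` converges, so that they do not
go on forever. -/
inductive Layer (t : ITree (H.sum F) R) (s : S) (u : ITree F T') :
    Step F T (ITree (H.sum F) R × S × ITree F T') → Prop
  | ret (r : R) (r' : R') (u' : ITree F T') (ht : observe t = .ret r) (hr : RR r r')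
      (hu : Taus u u') (hu' : observe u' = .ret (out' s r')) : Layer t s u (.ret (out s r))
  | tau (t' : ITree (H.sum F) R) (u' : ITree F T') (ht : observe t = .tau t')
      (hu : observe u = .tau u') (h' : RunsUpTo RR raise h out' t' s u') :
      Layer t s u (.tau (t', s, u'))
  | tauLeft (t' : ITree (H.sum F) R) (ht : observe t = .tau t') (hc : Converges t)
      (h' : RunsUpTo RR raise h out' t' s u) : Layer t s u (.tau (t', s, u))
  | keep (f : F.Op) (k : F.Ans f → ITree (H.sum F) R) (k' : F.Ans f → ITree F T') (u' : ITree F T')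
      (ht : observe t = .vis (.inr f) k) (hu : Taus u u') (hu' : observe u' = .vis f k')
      (h' : ∀ a, RunsUpTo RR raise h out' (k a) s (k' a)) :
      Layer t s u (.vis f fun a => (k a, s, k' a))
  | ok (e : H.Op) (k : H.Ans e → ITree (H.sum F) R) (s' : S) (a : H.Ans e) (u' u'' : ITree F T')
      (ht : observe t = .vis (.inl e) k) (he : Outcome.ok (s', a) ∈ h e s) (hu : Taus u u')
      (hu' : observe u' = .tau u'') (h' : RunsUpTo RR raise h out' (k a) s' u'') :
      Layer t s u (.tau (k a, s', u''))
  | err (e : H.Op) (k : H.Ans e → ITree (H.sum F) R) (x : Err)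
      (k' : F.Ans (raise x) → ITree F T') (u' : ITree F T')
      (k₁ : F.Ans (raise x) → ITree (H.sum F) R × S × ITree F T')
      (ht : observe t = .vis (.inl e) k) (he : Outcome.err x ∈ h e s) (hu : Taus u u')
      (hu' : observe u' = .vis (raise x) k') : Layer t s u (.vis (raise x) k₁)

variable {RR raise h out'}

theorem exists_layer (hraise : ∀ x, IsEmpty (F.Ans (raise x))) {t : ITree (H.sum F) R} {s : S}
    {u : ITree F T'} (hV : RunsUpTo RR raise h out' t s u) :
    ∃ st, Layer RR raise h out out' t s u st := by
  obtain ⟨t', htt', hr⟩ := hV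
  cases ht : observe t with
  | ret r =>
    obtain ⟨t₁, ht₁, r', hr', hrr⟩ := htt'.exists_of_ret ht
    obtain ⟨u₁, hu₁, hr₁⟩ := hr.exists_of_taus ht₁
    cases hr₁.dest <;> simp_all only [Step.ret.injEq, reduceCtorEq]
    subst_vars
    exact ⟨_, .ret r _ u₁ ht hrr hu₁ ‹_›⟩
  | tau t₁ =>
    cases ht' : observe t' with
    | tau t₁' =>
      obtain ⟨u', hu, hr'⟩ := hr.exists_of_tau ht'
      exact ⟨_, .tau t₁ u' ht hu
        ⟨t₁', Eutt.of_tau_right ht' (WeakSim.of_tau_left ht htt'), hr'⟩⟩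
    | ret _ =>
      exact ⟨_, .tauLeft t₁ ht (htt'.converges (by simp [ht']))
        ⟨t', WeakSim.of_tau_left ht htt', hr⟩⟩
    | vis _ _ =>
      exact ⟨_, .tauLeft t₁ ht (htt'.converges (by simp [ht']))
        ⟨t', WeakSim.of_tau_left ht htt', hr⟩⟩
  | vis e k =>
    obtain ⟨t₁, ht₁, k₁, hk₁, hkk⟩ := htt'.exists_of_vis ht
    obtain ⟨u₁, hu₁, hr₁⟩ := hr.exists_of_taus ht₁
    cases hr₁.dest with
    | ret _ ht' => rw [hk₁] at ht'; cases ht'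
    | tau _ _ ht' => rw [hk₁] at ht'; cases ht'
    | keep f k₂ k' ht' hu h' =>
      rw [hk₁] at ht'
      cases ht'
      exact ⟨_, .keep f k k' u₁ ht hu₁ hu fun a => ⟨_, hkk a, h' a⟩⟩
    | ok e k₂ s' a u' ht' he hu h' =>
      rw [hk₁] at ht'
      cases ht'
      exact ⟨_, .ok e k s' a u₁ u' ht he hu₁ hu ⟨_, hkk a, h'⟩⟩
    | err e k₂ x k' ht' he hu =>
      rw [hk₁] at ht'
      cases ht'
      exact ⟨_, .err e k x k' u₁ (fun a => (hraise x).elim a) ht he hu₁ hu⟩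

/-- Equivalent trees have equivalent runs. -/
theorem Runs.exists_of_eutt {RR' : T → T' → Prop}
    (hout : ∀ s r r', RR r r' → RR' (out s r) (out' s r')) (hraise : ∀ x, IsEmpty (F.Ans (raise x)))
    {t : ITree (H.sum F) R} {t' : ITree (H.sum F) R'}
    {s : S} {u' : ITree F T'} (htt' : Eutt RR t t') (hr : Runs raise h out' t' s u') :
    ∃ u, Runs raise h out t s u ∧ Eutt RR' u u' := by
  have hex (q : ITree (H.sum F) R × S × ITree F T') : ∃ st,
      RunsUpTo RR raise h out' q.1 q.2.1 q.2.2 →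
        Layer RR raise h out out' q.1 q.2.1 q.2.2 st := by
    by_cases hq : RunsUpTo RR raise h out' q.1 q.2.1 q.2.2
    · exact (exists_layer out hraise hq).imp fun _ h _ => h
    · exact ⟨.tau q, fun h => absurd h hq⟩
  choose step hstep using hex
  have hV : RunsUpTo RR raise h out' t s u' := ⟨t', htt', hr⟩
  refine ⟨unfold step (t, s, u'), ⟨fun t s u => ∃ u', RunsUpTo RR raise h out' t s u' ∧
    u = unfold step (t, s, u'), ?_, u', hV, rfl⟩, ⟨fun u u' => ∃ t s,
    RunsUpTo RR raise h out' t s u' ∧ u = unfold step (t, s, u'), ?_, t, s, hV, rfl⟩⟩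
  · clear htt' hr hV
    rintro t s _ ⟨u', hV, rfl⟩
    have hL := hstep (t, s, u') hV
    generalize hst : step (t, s, u') = st at hL
    cases hL with
    | ret r r' _ ht => exact .ret r ht (observe_unfold_ret hst)
    | tau t₁ u₁ ht hu h' => exact .tau _ _ ht (observe_unfold_tau hst) ⟨u₁, h', rfl⟩
    | tauLeft t₁ ht hc h' => exact .tau _ _ ht (observe_unfold_tau hst) ⟨u', h', rfl⟩
    | keep f k k' u₁ ht hu hu' h' =>
      exact .keep f k _ ht (observe_unfold_vis hst) fun a => ⟨k' a, h' a, rfl⟩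
    | ok e k s' a u₁ u₂ ht he hu hu' h' =>
      exact .ok e k s' a _ ht he (observe_unfold_tau hst) ⟨u₂, h', rfl⟩
    | err e k x k' u₁ k₁ ht he => exact .err e k x _ ht he (observe_unfold_vis hst)
  · clear htt' hr hV
    rintro _ u' ⟨t, s, hV, rfl⟩
    -- The layers of the replayed run and of `u'` match, except for the unpaired silent steps of `t`,
    -- which `ih` deals with; there are finitely many of them, by the induction on `Converges t`.
    have key (t : ITree (H.sum F) R) (hV : RunsUpTo RR raise h out' t s u')
        (ih : ∀ t₁, observe t = .tau t₁ → Converges t → RunsUpTo RR raise h out' t₁ s u' →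
          WeakSimF RR' (fun _ => False) (fun u u' => ∃ t s, RunsUpTo RR raise h out' t s u' ∧
            u = unfold step (t, s, u')) (unfold step (t₁, s, u')) u') :
        WeakSimF RR' (fun _ => False) (fun u u' => ∃ t s, RunsUpTo RR raise h out' t s u' ∧
          u = unfold step (t, s, u')) (unfold step (t, s, u')) u' := by
      have hL := hstep (t, s, u') hV
      generalize hst : step (t, s, u') = st at hL
      cases hL with
      | ret r r' _ ht hrr hu hu' =>
        exact .taus_right hu (.ret _ _ (observe_unfold_ret hst) hu' (hout s r r' hrr))
      | tau t₁ u₁ ht hu h' => exact .tau _ _ (observe_unfold_tau hst) hu ⟨t₁, s, h', rfl⟩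
      | tauLeft t₁ ht hc h' => exact .tauL _ (observe_unfold_tau hst) (ih t₁ ht hc h')
      | keep f k k' u₁ ht hu hu' h' =>
        exact .taus_right hu
          (.vis f _ _ (observe_unfold_vis hst) hu' fun a => ⟨k a, s, h' a, rfl⟩)
      | ok e k s' a u₁ u₂ ht he hu hu' h' =>
        exact .taus_right hu (.tau _ _ (observe_unfold_tau hst) hu' ⟨k a, s', h', rfl⟩)
      | err e k x k' u₁ k₁ ht he hu hu' =>
        exact .taus_right hu
          (.vis _ _ _ (observe_unfold_vis hst) hu' fun a => (hraise x).elim a)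
    by_cases hc : Converges t
    · obtain ⟨t', htt', ht'⟩ := hc
      induction htt' using Relation.ReflTransGen.head_induction_on with
      | refl => exact key _ hV fun t₁ ht => absurd ht (ht' t₁)
      | head ht _ ih =>
        refine key _ hV fun t₁ ht₁ _ hV₁ => ?_
        rw [ht] at ht₁
        cases ht₁
        exact ih hV₁
    · exact key t hV fun _ _ h => absurd h hc

end

end ITree

/-! ### The levels of interpretation -/

variable {X : Phase}

/-- Undefined behaviour is invariant under equivalence. -/
theorem HasUB.of_eutt {R R' : Type} {RR : R → R' → Prop} {t : ITree (E5 X) R}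
    {u : ITree (E5 X) R'} (h : ITree.Eutt RR t u) (hu : HasUB u) : HasUB t := by
  have of_taus {t t' : ITree (E5 X) R} (ht : ITree.Taus t t') (h : HasUB t') : HasUB t := by
    induction ht using Relation.ReflTransGen.head_induction_on with
    | refl => exact h
    | head ht _ ih => exact .tau _ _ ht ih
  induction hu generalizing t with
  | here u k hk =>
    obtain ⟨t', ht, k', hk', _⟩ := h.symm.exists_of_vis hk
    exact of_taus ht (.here _ _ hk')
  | tau u u' hu _ ih => exact ih (h.of_tau_right hu)
  | vis u e k hk a _ ih =>
    obtain ⟨t', ht, k', hk', hkk⟩ := h.symm.exists_of_vis hk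
    exact of_taus ht (.vis _ e k' hk' a (ih (hkk a).symm))

theorem EuttOOM.of_eutt {R R' : Type} {RR : R → R' → Prop} {t : ITree (E5 X) R}
    {u : ITree (E5 X) R'} (h : ITree.Eutt RR t u) : EuttOOM RR t u :=
  ITree.WeakSim.mono (fun _ _ h => h) (fun _ h => h.elim) h

theorem RefinesPick.refinesUB {P Q : Set (ITree (E5 X) (Res4 X))} (h : RefinesPick P Q) :
    RefinesUB P Q := fun t' ht' =>
  let ⟨t, ht, htt'⟩ := h t' ht'
  ⟨t, ht, .inr htt'⟩

theorem RefinesUB.refinesVIR {P Q : Set (ITree (E5 X) (Res4 X))} (h : RefinesUB P Q) :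
    RefinesVIR P Q := fun t' ht' =>
  let ⟨t, ht, htt'⟩ := h t' ht'
  ⟨t, ht, htt'.imp_right .of_eutt⟩

theorem refinesMem_modelMem (m : Mem X) {t t' : ITree (E3 X) (Res3 X)}
    (h : ITree.Eutt EqRes3 t t') : RefinesMem (modelMem X m t) (modelMem X m t') := fun _ hu' =>
  ITree.Runs.exists_of_eutt (RR' := EqRes4) Prod.mk (fun _ _ _ h => h)
    (fun _ => inferInstanceAs (IsEmpty Empty)) h hu'

theorem RefinesMem.modelPick {P Q : Set (ITree (E4 X) (Res4 X))} (h : RefinesMem P Q) :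
    RefinesPick (modelPick X P) (modelPick X Q) := by
  rintro u' ⟨t', ht', hu'⟩
  obtain ⟨t, ht, htt'⟩ := h t' ht'
  obtain ⟨u, hu, huu'⟩ := ITree.Runs.exists_of_eutt (H := PickE X) (S := Unit) (raise := err5 X)
    (out' := fun _ r => r) (RR' := EqRes4) (fun _ r => r) (fun _ _ _ h => h)
    (fun _ => inferInstanceAs (IsEmpty Empty)) htt' hu'
  exact ⟨u, ⟨t, ht, hu⟩, huu'⟩

theorem RefinesPick.modelUB {P Q : Set (ITree (E5 X) (Res4 X))} (h : RefinesPick P Q) :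
    RefinesUB (modelUB X P) (modelUB X Q) := by
  rintro u' (hu' | ⟨t', ht', hub⟩)
  · obtain ⟨t, ht, htu'⟩ := h u' hu'
    exact ⟨t, .inl ht, .inr htu'⟩
  · obtain ⟨t, ht, htt'⟩ := h t' ht'
    exact ⟨t, .inl ht, .inl (hub.of_eutt htt')⟩

theorem RefinesUB.modelOOM {P Q : Set (ITree (E5 X) (Res4 X))} (h : RefinesUB P Q) :
    RefinesVIR (modelOOM X P) (modelOOM X Q) := by
  rintro u' ⟨t', ht', htu'⟩
  obtain ⟨t, ht, htt'⟩ := h t' ht'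
  refine ⟨t, ⟨t, ht, ITree.WeakSim.refl _ _ (fun _ => rfl) t⟩, htt'.imp_right fun htt' => ?_⟩
  exact ITree.WeakSim.trans (by rintro a b _ h rfl; exact h) htt' htu'

theorem RefinesAt.interpStep (I : Intrinsics X) (s : Start X) :
    ∀ (n : ℕ) (P Q : BehaviourAt X n), RefinesAt X n P Q →
      RefinesAt X (n + 1) (interpStep I s n P) (interpStep I s n Q)
  | 0, _, _, h => ITree.eutt_interp I h
  | 1, _, _, h => ITree.WeakSim.mono (fun _ _ h => h) (fun _ h => h)
      (ITree.eutt_interpState (handleGlobal X) h s.g)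
  | 2, _, _, h => ITree.WeakSim.mono (fun _ _ h => h) (fun _ h => h)
      (ITree.eutt_interpState (handleLocal X) h s.l)
  | 3, _, _, h => refinesMem_modelMem s.m h
  | 4, _, _, h => RefinesMem.modelPick h
  | 5, _, _, h => RefinesPick.modelUB h
  | 6, _, _, h => RefinesUB.modelOOM h
  | _ + 7, _, _, h => h

theorem Refines.interpTo (I : Intrinsics X) (s : Start X) {ℓ ℓ' : Level} (h : ℓ ≤ ℓ')
    {P Q : Behaviour X ℓ} (hPQ : Refines ℓ P Q) :
    Refines ℓ' (interpTo I s h P) (interpTo I s h Q) := by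
  have key {m n : ℕ} (hmn : m ≤ n) {P Q : BehaviourAt X m} (hPQ : RefinesAt X m P Q) :
      RefinesAt X n (Nat.leRecOn (C := BehaviourAt X) hmn (fun {k} => interpStep I s k) P)
        (Nat.leRecOn (C := BehaviourAt X) hmn (fun {k} => interpStep I s k) Q) := by
    induction n, hmn using Nat.le_induction with
    | base => simpa only [Nat.leRecOn_self] using hPQ
    | succ n hmn ih =>
      rw [Nat.leRecOn_succ hmn, Nat.leRecOn_succ hmn]
      exact RefinesAt.interpStep I s n _ _ ih
  exact key (Fin.le_def.mp h) hPQ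

end VIR

theorem mainTheorem6 (X : VIR.Phase) (I : VIR.Intrinsics X) (s : VIR.Start X) :
    (∀ (ℓ ℓ' : VIR.Level) (h : ℓ ≤ ℓ') (P Q : VIR.Behaviour X ℓ),
      VIR.Refines ℓ P Q → VIR.Refines ℓ' (VIR.interpTo I s h P) (VIR.interpTo I s h Q)) ∧
    (∀ (ℓ : VIR.Level) (P Q : VIR.Behaviour X ℓ), VIR.Refines ℓ P Q →
      VIR.RefinesVIR (X := X) (VIR.interpTo (ℓ' := VIR.Level.top) I s (Fin.le_last ℓ) P)
        (VIR.interpTo (ℓ' := VIR.Level.top) I s (Fin.le_last ℓ) Q)) ∧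
    (∀ P Q : Set (VIR.ITree (VIR.E5 X) (VIR.Res4 X)),
      (VIR.RefinesPick P Q → VIR.RefinesUB P Q) ∧ (VIR.RefinesUB P Q → VIR.RefinesVIR P Q)) := by
  have h₁ (ℓ ℓ' : VIR.Level) (h : ℓ ≤ ℓ') (P Q : VIR.Behaviour X ℓ) (hPQ : VIR.Refines ℓ P Q) :
      VIR.Refines ℓ' (VIR.interpTo I s h P) (VIR.interpTo I s h Q) := VIR.Refines.interpTo I s h hPQ
  exact ⟨h₁, fun ℓ P Q hPQ => h₁ ℓ VIR.Level.top (Fin.le_last ℓ) P Q hPQ,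
    fun P Q => ⟨VIR.RefinesPick.refinesUB, VIR.RefinesUB.refinesVIR⟩⟩
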